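/- Let $M$ and $N$ be $C^\infty$-manifolds in the sense of convenient calculus, i.e. sets with an atlas of charts onto $c^\infty$-open subsets of convenient (that is, $c^\infty$-complete Hausdorff locally convex real) vector spaces whose chart changings are smooth, where the model space may vary from chart to chart and a map between $c^\infty$-open sets is smooth if it maps smooth curves to smooth curves. Assume that $M$ and $N$ are separated as arc-generated spaces, i.e. that the diagonal is closed in the product formed in the category of arc-generated spaces. Regard $M$ and $N$ as diffeological spaces whose plots are the $C^\infty$-parametrizations. For a diffeological space $X$ and an integer $d$ with $0<d<\infty$, let $X_d$ be the set $X$ with the $d$-skeletal diffeology, i.e. the diffeology generated by the plots of $X$ of dimension $\le d$. For diffeological spaces $X,Y$ let $\mathcal D(X,Y)$ be the set of smooth maps $X\to Y$ with the functional diffeology: $p:U\to\mathcal D(X,Y)$ is a plot iff $U\times X\to Y$, $(r,x)\mapsto p(r)(x)$, is smooth. Let $d$ be an integer with $0<d<\infty$. (1) As sets of maps, $C^\infty(M,N)=\mathcal D(M,N)=\mathcal D(M_d,N_d)$, where $C^\infty(M,N)$ is the set of smooth maps of manifolds from $M$ to $N$. (2) Suppose that $d<\dim T_xM$ for every $x\in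 M$ (that is, $d<\dim M$ if all tangent spaces of $M$ have the same dimension; infinite dimension is allowed). If $f:M\to N$ is an immersion, i.e. a smooth map such that $T_xf:T_xM\to T_{f(x)}N$ is injective for every $x\in M$, then $\{f\}$ is a connected component of $\mathcal D(M_d,N_d)$, i.e. $f$ is isolated: $f$ is the only $g\in\mathcal D(M_d,N_d)$ for which there is a smooth path $\gamma:\mathbb R\to\mathcal D(M_d,N_d)$ with $\gamma(0)=f$ and $\gamma(1)=g$, and equivalently $\{f\}$ is the connected component of $f$ for the D-topology (the final topology for the plots) of $\mathcal D(M_d,N_d)$. -/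

import Mathlib

open scoped Topology ContDiff
open Filter Diffeology

universe u v uM vM uN vN

namespace Convenient

/-! ### Smooth curves and the `c^∞`-topology of a locally convex space -/

section Curves

variable {E : Type*} [AddCommGroup E] [Module ℝ E] [TopologicalSpace E]

/-- The curve `c` is differentiable at `t` with derivative `v`:
the difference quotients `(c (t + s) - c t) / s` converge to `v` as `s → 0`, `s ≠ 0`. -/
def HasVelocityAt (c : ℝ → E) (v : E) (t : ℝ) : Prop :=
  Tendsto (fun s : ℝ => s⁻¹ • (c (t + s) - c t)) (𝓝[≠] 0) (𝓝 v)

/-- A curve is smooth if all its iterated derivatives exist everywhere;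
`D k` is the `k`-th derivative. -/
def SmoothCurve (c : ℝ → E) : Prop :=
  ∃ D : ℕ → ℝ → E, D 0 = c ∧ ∀ k t, HasVelocityAt (D k) (D (k + 1) t) t

variable (E) in
/-- The `c^∞`-topology: the final topology for the smooth curves `ℝ → E`. -/
@[reducible]
def cInftyTopology : TopologicalSpace E :=
  ⨆ c : {c : ℝ → E // SmoothCurve c}, TopologicalSpace.coinduced c.1 inferInstance

/-- `W` is `c^∞`-open. -/
def IsCInftyOpen (W : Set E) : Prop := IsOpen[cInftyTopology E] W

theorem isCInftyOpen_iff {W : Set E} :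
    IsCInftyOpen W ↔ ∀ c : ℝ → E, SmoothCurve c → IsOpen (c ⁻¹' W) := by
  rw [IsCInftyOpen, cInftyTopology, isOpen_iSup_iff]
  exact ⟨fun h c hc => isOpen_coinduced.1 (h ⟨c, hc⟩), fun h c => isOpen_coinduced.2 (h c.1 c.2)⟩

/-- Smoothness of a map `g` on a (`c^∞`-open) subset `W`:
smooth curves in `W` are mapped to smooth curves. -/
def SmoothOn {F : Type*} [AddCommGroup F] [Module ℝ F] [TopologicalSpace F]
    (g : E → F) (W : Set E) : Prop :=
  ∀ c : ℝ → E, SmoothCurve c → (∀ t, c t ∈ W) → SmoothCurve (g ∘ c)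

/-- The derivative of `g` at `y` in the direction `h` exists and equals `w`, i.e.
`dg(y)(h) = w`. -/
def HasDirDerivAt {F : Type*} [AddCommGroup F] [Module ℝ F] [TopologicalSpace F]
    (g : E → F) (y h : E) (w : F) : Prop :=
  HasVelocityAt (fun t : ℝ => g (y + t • h)) w 0

theorem smoothCurve_const (x : E) : SmoothCurve (fun _ : ℝ => x) := by
  refine ⟨fun k _ => if k = 0 then x else 0, by simp, fun k t => ?_⟩
  simp only [HasVelocityAt, sub_self, smul_zero, Nat.succ_ne_zero, if_false]
  exact tendsto_const_nhds

end Curves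

theorem smoothCurve_iff_contDiff {E : Type*} [NormedAddCommGroup E] [NormedSpace ℝ E]
    {c : ℝ → E} : SmoothCurve c ↔ ContDiff ℝ ∞ c := by
  constructor
  · rintro ⟨D, rfl, hD⟩
    have hd : ∀ k t, HasDerivAt (D k) (D (k + 1) t) t := fun k t =>
      hasDerivAt_iff_tendsto_slope_zero.2 (hD k t)
    have key : ∀ m : ℕ, ∀ k, ContDiff ℝ m (D k) := by
      intro m
      induction m with
      | zero =>
        intro k
        exact contDiff_zero.2 (continuous_iff_continuousAt.2 fun t => (hd k t).continuousAt)
      | succ m ih =>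
        intro k
        have hderiv : deriv (D k) = D (k + 1) := funext fun t => (hd k t).deriv
        rw [Nat.cast_succ, contDiff_succ_iff_deriv]
        refine ⟨fun t => (hd k t).differentiableAt, by simp, ?_⟩
        rw [hderiv]
        exact ih (k + 1)
    exact contDiff_infty.2 fun m => key m 0
  · intro hc
    have key : ∀ k : ℕ, ContDiff ℝ ∞ (deriv^[k] c) := by
      intro k
      induction k with
      | zero => exact hc
      | succ k ih =>
        rw [Function.iterate_succ_apply']
        exact (contDiff_infty_iff_deriv.1 ih).2
    refine ⟨fun k => deriv^[k] c, rfl, fun k t => ?_⟩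
    have h := ((contDiff_infty_iff_deriv.1 (key k)).1 t).hasDerivAt
    rw [← Function.iterate_succ_apply' deriv k c] at h
    exact hasDerivAt_iff_tendsto_slope_zero.1 h

/-! ### Convenient vector spaces and manifolds modelled on them -/

/-- A convenient vector space: a Hausdorff real locally convex space that is `c^∞`-complete,
i.e. in which every smooth curve has a smooth antiderivative. -/
structure ConvenientSpace : Type (v + 1) where
  /-- The underlying set. -/
  carrier : Type v
  [addCommGroup : AddCommGroup carrier]
  [module : Module ℝ carrier]
  [topologicalSpace : TopologicalSpace carrier]
  [isTopologicalAddGroup : IsTopologicalAddGroup carrier]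
  [continuousSMul : ContinuousSMul ℝ carrier]
  [t2Space : T2Space carrier]
  [locallyConvexSpace : LocallyConvexSpace ℝ carrier]
  exists_antiderivative : ∀ c : ℝ → carrier, SmoothCurve c →
    ∃ C : ℝ → carrier, SmoothCurve C ∧ ∀ t, HasVelocityAt C (c t) t

instance : CoeSort ConvenientSpace (Type v) := ⟨ConvenientSpace.carrier⟩

attribute [instance] ConvenientSpace.addCommGroup ConvenientSpace.module
  ConvenientSpace.topologicalSpace ConvenientSpace.isTopologicalAddGroup
  ConvenientSpace.continuousSMul ConvenientSpace.t2Space ConvenientSpace.locallyConvexSpace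

/-- A chart on the set `M`: a bijection from a subset `source` of `M` onto a `c^∞`-open subset
`target` of a convenient vector space. Different charts may have different model spaces. -/
structure Chart (M : Type u) where
  /-- The model space. -/
  model : ConvenientSpace.{v}
  /-- The bijection `source ≃ target`. -/
  equiv : PartialEquiv M model
  isCInftyOpen_target : IsCInftyOpen equiv.target

/-- A `C^∞`-manifold structure on `M` in the sense of convenient calculus, given by a
`C^∞`-atlas: the charts cover `M`, and all chart changings are smooth maps defined on
`c^∞`-open sets. -/
structure Manifold (M : Type u) where
  /-- The charts of the atlas. -/
  atlas : Set (Chart.{u, v} M)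
  exists_chart : ∀ x : M, ∃ φ ∈ atlas, x ∈ φ.equiv.source
  isCInftyOpen_overlap : ∀ φ ∈ atlas, ∀ ψ ∈ atlas,
    IsCInftyOpen (φ.equiv '' (φ.equiv.source ∩ ψ.equiv.source))
  smoothOn_change : ∀ φ ∈ atlas, ∀ ψ ∈ atlas,
    SmoothOn (ψ.equiv ∘ φ.equiv.symm) (φ.equiv '' (φ.equiv.source ∩ ψ.equiv.source))

/-- The arc-generated topology associated with a topology:
the final topology for the continuous curves `ℝ → X`. -/
@[reducible]
def arcGenerated {X : Type*} (t : TopologicalSpace X) : TopologicalSpace X :=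
  ⨆ c : {c : ℝ → X // Continuous[inferInstance, t] c},
    TopologicalSpace.coinduced c.1 inferInstance

/-- A topological space is separated (as an arc-generated space) if its diagonal is closed in
`X × X`, the product being taken in the category of arc-generated spaces. -/
def IsSeparated {X : Type*} (t : TopologicalSpace X) : Prop :=
  IsClosed[arcGenerated (@instTopologicalSpaceProd X X t t)] (Set.diagonal X)

namespace Manifold

variable {M : Type*} {N : Type*}

/-- The natural topology of a manifold: `W` is open iff its image in every chart is
`c^∞`-open. -/
@[reducible]
def topology (A : Manifold M) : TopologicalSpace M where
  IsOpen W := ∀ φ ∈ A.atlas, IsCInftyOpen (φ.equiv '' (φ.equiv.source ∩ W))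
  isOpen_univ := fun φ _ => by
    rw [Set.inter_univ, φ.equiv.image_source_eq_target]
    exact φ.isCInftyOpen_target
  isOpen_inter := fun s t hs ht φ hφ => by
    have h : φ.equiv '' (φ.equiv.source ∩ (s ∩ t)) =
        φ.equiv '' (φ.equiv.source ∩ s) ∩ φ.equiv '' (φ.equiv.source ∩ t) := by
      rw [← φ.equiv.injOn.image_inter Set.inter_subset_left Set.inter_subset_left,
        Set.inter_inter_distrib_left]
    rw [h]
    exact @IsOpen.inter _ (cInftyTopology _) _ _ (hs φ hφ) (ht φ hφ)
  isOpen_sUnion := fun S hS φ hφ => by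
    have h : φ.equiv '' (φ.equiv.source ∩ ⋃₀ S) =
        ⋃ s ∈ S, φ.equiv '' (φ.equiv.source ∩ s) := by
      rw [Set.sUnion_eq_biUnion, Set.inter_iUnion₂, Set.image_iUnion₂]
    rw [h]
    exact @isOpen_biUnion _ _ (cInftyTopology _) _ _ fun s hs => hS s hs φ hφ

/-- Smooth maps of manifolds: for each `x` and each chart `ψ` of `N` at `f x` there are a chart
`φ` of `M` at `x` and a `c^∞`-open neighbourhood `W ⊆ φ(source)` of `φ x` such that `f` maps
`φ⁻¹(W)` into the domain of `ψ` and `ψ ∘ f ∘ φ⁻¹` is smooth on `W`. -/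
def IsSmooth (A : Manifold M) (B : Manifold N) (f : M → N) : Prop :=
  ∀ x : M, ∀ ψ ∈ B.atlas, f x ∈ ψ.equiv.source →
    ∃ φ ∈ A.atlas, x ∈ φ.equiv.source ∧
      ∃ W : Set φ.model, IsCInftyOpen W ∧ φ.equiv x ∈ W ∧ W ⊆ φ.equiv.target ∧
        (∀ y ∈ W, f (φ.equiv.symm y) ∈ ψ.equiv.source) ∧
        SmoothOn (ψ.equiv ∘ f ∘ φ.equiv.symm) W

/-- An immersion is a smooth map `f` all of whose tangent maps `T_x f : T_x M → T_{f x} N` are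
injective. A chart `φ` at `x` identifies `T_x M` with the model space of `φ`, and in charts
`φ`, `ψ` the map `T_x f` is the derivative `d(ψ ∘ f ∘ φ⁻¹)(φ x)`, which exists in every
direction because `f` is smooth. -/
def IsImmersion (A : Manifold M) (B : Manifold N) (f : M → N) : Prop :=
  A.IsSmooth B f ∧
    ∀ x : M, ∀ φ ∈ A.atlas, x ∈ φ.equiv.source → ∀ ψ ∈ B.atlas, f x ∈ ψ.equiv.source →
      ∀ (h₁ h₂ : φ.model) (w : ψ.model),
        HasDirDerivAt (ψ.equiv ∘ f ∘ φ.equiv.symm) (φ.equiv x) h₁ w →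
        HasDirDerivAt (ψ.equiv ∘ f ∘ φ.equiv.symm) (φ.equiv x) h₂ w → h₁ = h₂

/-- `d < dim T_x M` for every `x` (infinite-dimensional tangent spaces are allowed). For a
manifold all of whose tangent spaces have the same dimension this says `d < dim M`. -/
def DimGT (A : Manifold M) (d : ℕ) : Prop :=
  ∀ x : M, ∀ φ ∈ A.atlas, x ∈ φ.equiv.source → (d : Cardinal) < Module.rank ℝ φ.model

/-- `p` is a `C^∞`-parametrization of the manifold on the open subset `U` of `ℝⁿ`, i.e. a smooth
map of manifolds `U → M`. (On `ℝⁿ` the `c^∞`-topology is the usual one.) -/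
def IsParametrizationOn (A : Manifold M) {n : ℕ} (U : Set (EuclideanSpace ℝ (Fin n)))
    (p : EuclideanSpace ℝ (Fin n) → M) : Prop :=
  ∀ x ∈ U, ∀ ψ ∈ A.atlas, p x ∈ ψ.equiv.source →
    ∃ W : Set (EuclideanSpace ℝ (Fin n)), IsOpen W ∧ x ∈ W ∧ W ⊆ U ∧
      (∀ y ∈ W, p y ∈ ψ.equiv.source) ∧ SmoothOn (ψ.equiv ∘ p) W

/-- The diffeology of a manifold: its plots are the `C^∞`-parametrizations. -/
@[reducible]
def diffeology (A : Manifold M) : DiffeologicalSpace M :=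
  .ofCorePlotsOn {
    isPlotOn := fun {_ U} _ p => A.IsParametrizationOn U p
    isPlotOn_congr := by
      have key : ∀ {n : ℕ} {U : Set (EuclideanSpace ℝ (Fin n))}
          {p q : EuclideanSpace ℝ (Fin n) → M}, Set.EqOn p q U →
          A.IsParametrizationOn U p → A.IsParametrizationOn U q := by
        intro n U p q h hp x hx ψ hψ hxψ
        obtain ⟨W, hW, hxW, hWU, hWψ, hs⟩ := hp x hx ψ hψ (by rw [h hx]; exact hxψ)
        refine ⟨W, hW, hxW, hWU, fun y hy => by rw [← h (hWU hy)]; exact hWψ y hy, ?_⟩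
        intro c hc hcW
        have he : (ψ.equiv ∘ q) ∘ c = (ψ.equiv ∘ p) ∘ c :=
          funext fun t => congrArg ψ.equiv (h (hWU (hcW t))).symm
        rw [he]
        exact hs c hc hcW
      exact fun {_ _} _ {_ _} h => ⟨key h, key h.symm⟩
    isPlot_const := fun x y _ ψ hψ hxψ =>
      ⟨Set.univ, isOpen_univ, trivial, subset_rfl, fun _ _ => hxψ,
        fun _ _ _ => smoothCurve_const _⟩
    isPlotOn_reparam := by
      intro n m U V hU hV p f h hp hf x hx ψ hψ hxψ
      obtain ⟨W, hW, hxW, hWU, hWψ, hs⟩ := hp (f x) (h hx) ψ hψ hxψ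
      refine ⟨V ∩ f ⁻¹' W, hf.continuousOn.isOpen_inter_preimage hV hW, ⟨hx, hxW⟩,
        Set.inter_subset_left, fun y hy => hWψ _ hy.2, ?_⟩
      intro c hc hcW
      refine hs (f ∘ c) ?_ fun t => (hcW t).2
      rw [smoothCurve_iff_contDiff] at hc ⊢
      exact hf.comp_contDiff hc fun t => (hcW t).1
    locality := by
      intro n U hU p hp x hx ψ hψ hxψ
      obtain ⟨V, hV, hxV, hpV⟩ := hp x hx
      obtain ⟨W, hW, hxW, hWV, hWψ, hs⟩ := hpV x hxV ψ hψ hxψ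
      refine ⟨W ∩ U, hW.inter hU, ⟨hxW, hx⟩, Set.inter_subset_right,
        fun y hy => hWψ y hy.1, fun c hc hcW => hs c hc fun t => (hcW t).1⟩ }

end Manifold

/-! ### Skeletal diffeologies, spaces of smooth maps, components -/

/-- The `d`-skeletal diffeology: the diffeology generated by the plots of dimension `≤ d`. -/
@[reducible]
def skeleton {X : Type*} (d : ℕ) (D : DiffeologicalSpace X) : DiffeologicalSpace X :=
  .generateFrom {p | p.1 ≤ d ∧ @IsPlot X D p.1 p.2}

/-- The set `𝒟(X, Y)` of smooth maps between two diffeological spaces. -/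
def SmoothMaps {X Y : Type*} (DX : DiffeologicalSpace X) (DY : DiffeologicalSpace Y) : Type _ :=
  {f : X → Y // @DSmooth X Y DX DY f}

/-- The functional diffeology on `𝒟(X, Y)`: a map `p : ℝⁿ → 𝒟(X, Y)` is a plot iff
`ℝⁿ × X → Y`, `(r, x) ↦ p r x` is smooth, i.e. iff it sends every plot `(φ, q)` of the product
`ℝⁿ × X` to a plot of `Y`. -/
instance SmoothMaps.diffeology {X Y : Type*} (DX : DiffeologicalSpace X)
    (DY : DiffeologicalSpace Y) : DiffeologicalSpace (SmoothMaps DX DY) where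
  plots n := {p | ∀ (k : ℕ) (φ : EuclideanSpace ℝ (Fin k) → EuclideanSpace ℝ (Fin n))
    (q : EuclideanSpace ℝ (Fin k) → X), ContDiff ℝ ∞ φ → @IsPlot X DX k q →
      @IsPlot Y DY k (fun z => (p (φ z)).1 (q z))}
  constant_plots f := fun k _ q _ hq => f.2 k q hq
  plot_reparam hp hf := fun k φ q hφ hq => hp k _ q (hf.comp hφ) hq
  locality := by
    intro n p hp k φ q hφ hq
    refine DY.locality fun z => ?_
    obtain ⟨U, hU, hzU, h⟩ := hp (φ z)
    refine ⟨φ ⁻¹' U, hU.preimage hφ.continuous, hzU, ?_⟩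
    intro m f hfU hf
    exact h (f := φ ∘ f) hfU (hφ.comp hf) m id (q ∘ f) contDiff_id (DX.plot_reparam hq hf)

/-- The connected component of `x` in a diffeological space: the points that can be joined to
`x` by a smooth path. -/
def smoothComponent {X : Type*} [DiffeologicalSpace X] (x : X) : Set X :=
  {y | ∃ γ : ℝ → X, DSmooth γ ∧ γ 0 = x ∧ γ 1 = y}

end Convenient

/-! Part (1) holds because smoothness on either side is detected by smooth curves, and smooth curves
are one-dimensional plots, which the `d`-skeleton retains as soon as `d > 0`.

For part (2), let `γ` be a smooth path starting at an immersion, let `x` be a point of `M`, and let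
`q` be a smooth slice of dimension `d + 1` through `x` in a chart. Put `Γ (t, y) = γ t (q y)`. On
`ℝ` times a hyperplane parallel to the `i`-th coordinate hyperplane, `q` is a `d`-dimensional plot,
so `Γ` restricts there to a plot of `N_d`. Such a plot factors locally through dimension at most
`d`, so its derivative on this `(d + 1)`-dimensional space has a kernel. Where `∂_y Γ` is injective,
a kernel vector has nonzero time component and can be scaled to `(1, w i)` with `w i` in the `i`-th
hyperplane. Injectivity forces all `w i` to coincide; their common value lies in every coordinate
hyperplane, hence is zero, and `∂_t Γ = 0` (`fderiv_time_eq_zero`). Thus `Γ` is locally constant in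
time there. The times at which `Γ (t, 0)` and `∂_y Γ (t, 0)` have their initial values form an open
set, and a closed one since `N` is separated; so `γ t x = γ 0 x` for all `t` (`eq_of_immersive`).

The derivatives are taken after composition with continuous linear functionals, which separate
points. This needs only a weak form of Boman's theorem: functions smooth along curves are `C¹`
(`contDiffOn_one_of_forall_curve`). -/

namespace Convenient

/-! ### Cut-offs, the special curve lemma, and the `c^∞`-topology of a Banach space. -/

section Analysis

/-- A smooth self-map with values in a given neighbourhood of `x` that is the identity near `x`. -/
theorem exists_contDiff_eventuallyEq_id {X : Type*} [NormedAddCommGroup X] [NormedSpace ℝ X]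
    [FiniteDimensional ℝ X] {O : Set X} {x : X} (hO : O ∈ 𝓝 x) :
    ∃ θ : X → X, ContDiff ℝ ∞ θ ∧ θ =ᶠ[𝓝 x] id ∧ ∀ z, θ z ∈ O := by
  obtain ⟨ε, hε, hεO⟩ := Metric.mem_nhds_iff.1 hO
  let χ : ContDiffBump x := ⟨ε / 2, ε, by positivity, by linarith⟩
  refine ⟨fun z => x + χ z • (z - x), ?_, ?_, fun z => hεO ?_⟩
  · exact contDiff_const.add (χ.contDiff.smul (contDiff_id.sub contDiff_const))
  · filter_upwards [χ.eventuallyEq_one] with z hz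
    simp [hz]
  · rw [Metric.mem_ball, dist_eq_norm, add_sub_cancel_left, norm_smul, Real.norm_eq_abs,
      abs_of_nonneg χ.nonneg]
    by_cases hz : dist z x < ε
    · rw [dist_eq_norm] at hz
      calc χ z * ‖z - x‖ ≤ 1 * ‖z - x‖ := by gcongr; exact χ.le_one
        _ < ε := by simpa using hz
    · rw [χ.zero_of_le_dist (not_lt.1 hz)]
      simpa using hε

theorem exists_bound_iteratedFDeriv {f : ℝ → ℝ} (hf : ContDiff ℝ ∞ f) (hs : HasCompactSupport f)
    (n : ℕ) : ∃ K, ∀ i ≤ n, ∀ x, ‖iteratedFDeriv ℝ i f x‖ ≤ K := by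
  have h : ∀ i : ℕ, ∃ K, ∀ x, ‖iteratedFDeriv ℝ i f x‖ ≤ K := fun i =>
    (hs.iteratedFDeriv i).exists_bound_of_continuous
      (hf.continuous_iteratedFDeriv (m := i) (by exact_mod_cast le_top))
  choose K hK using h
  refine ⟨∑ i ∈ Finset.range (n + 1), |K i|, fun i hi x =>
    (hK i x).trans ((le_abs_self _).trans ?_)⟩
  exact Finset.single_le_sum (f := fun i => |K i|) (fun _ _ => abs_nonneg _)
    (Finset.mem_range.2 (by omega))

theorem norm_iteratedFDeriv_smul_const_le {E : Type*} [NormedAddCommGroup E] [NormedSpace ℝ E]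
    {f : ℝ → ℝ} (hf : ContDiff ℝ ∞ f) (w : E) (i : ℕ) (x : ℝ) :
    ‖iteratedFDeriv ℝ i (fun t => f t • w) x‖ ≤ ‖w‖ * ‖iteratedFDeriv ℝ i f x‖ := by
  have h := (ContinuousLinearMap.toSpanSingleton ℝ w).norm_iteratedFDeriv_comp_left
    (f := f) (x := x) (N := ∞) (n := i) hf.contDiffAt (by exact_mod_cast le_top)
  simpa [Function.comp_def] using h

variable {E : Type*} [NormedAddCommGroup E] [NormedSpace ℝ E]

variable (E) in
/-- The special curve lemma: sequences that converge fast enough, together with directions, lie on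
a smooth curve, with a prescribed rate. -/
theorem exists_special_curve [CompleteSpace E] : ∃ δ t : ℕ → ℝ, (∀ k, 0 < δ k) ∧
    Tendsto t atTop (𝓝 0) ∧ ∀ (y : E) (z v : ℕ → E), (∀ k, ‖z k - y‖ ≤ δ k) → (∀ k, ‖v k‖ ≤ 1) →
      ∃ c : ℝ → E, ContDiff ℝ ∞ c ∧ c 0 = y ∧
        ∀ k, ∀ᶠ s in 𝓝 (0 : ℝ), c (t k + s) = z k + (δ k * s) • v k := by
  let t : ℕ → ℝ := fun k => (1 / 2) ^ k
  have ht : ∀ k, 0 < t k := fun k => by positivity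
  let χ : ∀ k, ContDiffBump (t k) := fun k =>
    ⟨t k / 8, t k / 4, by have := ht k; positivity, by have := ht k; linarith⟩
  -- Distinct nodes `t j`, `t k` are at least half the larger one apart, so the bumps of radius `t k
  -- / 4` have disjoint supports.
  have hsep : ∀ j k, j ≠ k → t j / 2 ≤ |t k - t j| ∧ t k / 2 ≤ |t k - t j| := by
    have key : ∀ j k, j < k → t k ≤ t j / 2 := fun j k hjk => by
      have : t k ≤ t (j + 1) := pow_le_pow_of_le_one (by norm_num) (by norm_num) hjk
      rwa [show t (j + 1) = t j / 2 by simp only [t, pow_succ]; ring] at this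
    intro j k hjk
    rcases lt_or_gt_of_ne hjk with h | h
    · have := key _ _ h
      have := ht k
      rw [abs_sub_comm, abs_of_nonneg (by linarith)]
      constructor <;> linarith
    · have := key _ _ h
      have := ht j
      rw [abs_of_nonneg (by linarith)]
      constructor <;> linarith
  let χ' : ℕ → ℝ → ℝ := fun k s => (s - t k) * χ k s
  have hχ : ∀ k, ContDiff ℝ ∞ (χ k) := fun k => (χ k).contDiff
  have hχ' : ∀ k, ContDiff ℝ ∞ (χ' k) := fun k =>
    (contDiff_id.sub contDiff_const).mul (hχ k)
  choose K hK using fun k => exists_bound_iteratedFDeriv (hχ k) (χ k).hasCompactSupport k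
  choose K' hK' using fun k => exists_bound_iteratedFDeriv (hχ' k)
    ((χ k).hasCompactSupport.mul_left) k
  -- `B k` dominates the derivatives of order at most `k` of the bump and of the bump times `s - t
  -- k`. Hence `δ k = 2⁻ᵏ / B k` bounds those of the `k`-th summand by `2⁻ᵏ`.
  let B : ℕ → ℝ := fun k => 1 + |K k| + |K' k|
  have hB : ∀ k, 0 < B k := fun k => by positivity
  refine ⟨fun k => (1 / 2) ^ k / B k, t, fun k => by have := hB k; positivity,
    tendsto_pow_atTop_nhds_zero_of_lt_one (by norm_num) (by norm_num), ?_⟩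
  intro y z v hz hv
  set δ : ℕ → ℝ := fun k => (1 / 2) ^ k / B k with hδ
  have hδ0 : ∀ k, 0 < δ k := fun k => by have := hB k; positivity
  let F : ℕ → ℝ → E := fun k s => χ k s • (z k - y) + χ' k s • (δ k • v k)
  have hF1 : ∀ k, ContDiff ℝ ∞ (fun s => χ k s • (z k - y)) := fun k =>
    (hχ k).smul contDiff_const
  have hF2 : ∀ k, ContDiff ℝ ∞ (fun s => χ' k s • (δ k • v k)) := fun k =>
    (hχ' k).smul contDiff_const
  have hFzero : ∀ k s, t k / 4 ≤ |s - t k| → F k s = 0 := by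
    intro k s hs
    have : χ k s = 0 := (χ k).zero_of_le_dist (by rwa [Real.dist_eq])
    simp [F, χ', this]
  refine ⟨fun s => y + ∑' k, F k s, contDiff_const.add ?_, ?_, ?_⟩
  -- For fixed `i`, only the finitely many summands with `k < i` escape the bound on the `i`-th
  -- derivative.
  · refine contDiff_tsum_of_eventually (N := ⊤) (v := fun _ k => (1 / 2) ^ k)
      (fun k => (hF1 k).add (hF2 k)) (fun _ _ => summable_geometric_two) fun i _ => ?_
    rw [Nat.cofinite_eq_atTop]
    filter_upwards [eventually_ge_atTop i] with k hik s
    have e : iteratedFDeriv ℝ i (F k) s = iteratedFDeriv ℝ i (fun s => χ k s • (z k - y)) s +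
        iteratedFDeriv ℝ i (fun s => χ' k s • (δ k • v k)) s :=
      iteratedFDeriv_add_apply ((hF1 k).contDiffAt.of_le (by exact_mod_cast le_top))
        ((hF2 k).contDiffAt.of_le (by exact_mod_cast le_top))
    rw [e]
    have h1 := norm_iteratedFDeriv_smul_const_le (hχ k) (z k - y) i s
    have h2 := norm_iteratedFDeriv_smul_const_le (hχ' k) (δ k • v k) i s
    have h3 : ‖δ k • v k‖ ≤ δ k := by
      rw [norm_smul, Real.norm_eq_abs, abs_of_pos (hδ0 k)]
      exact mul_le_of_le_one_right (hδ0 k).le (hv k)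
    have h4 := (hK k i hik s).trans (le_abs_self _)
    have h5 := (hK' k i hik s).trans (le_abs_self _)
    calc _ ≤ ‖z k - y‖ * ‖iteratedFDeriv ℝ i (χ k) s‖ +
          ‖δ k • v k‖ * ‖iteratedFDeriv ℝ i (χ' k) s‖ := (norm_add_le _ _).trans (add_le_add h1 h2)
      _ ≤ δ k * |K k| + δ k * |K' k| := by
          gcongr
          exact hz k
      _ ≤ δ k * B k := by
          have := hδ0 k
          simp only [B]
          nlinarith
      _ = (1 / 2) ^ k := div_mul_cancel₀ _ (hB k).ne'
  · have : ∀ k, F k 0 = 0 := fun k => hFzero k 0 (by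
      rw [zero_sub, abs_neg, abs_of_pos (ht k)]
      linarith [ht k])
    simp [this]
  · intro k
    have hk : 0 < t k / 8 := by have := ht k; positivity
    filter_upwards [Metric.ball_mem_nhds (0 : ℝ) hk] with s hs
    rw [Metric.mem_ball, dist_zero_right, Real.norm_eq_abs] at hs
    have hoff : ∀ j, j ≠ k → F j (t k + s) = 0 := by
      intro j hj
      refine hFzero j _ ?_
      obtain ⟨h1, h2⟩ := hsep j k hj
      have : |t k - t j| ≤ |t k + s - t j| + |s| := by
        calc |t k - t j| = |(t k + s - t j) - s| := by ring_nf
          _ ≤ _ := abs_sub _ _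
      linarith
    rw [tsum_eq_single k hoff]
    have : χ k (t k + s) = 1 := (χ k).one_of_mem_closedBall (by
      rw [Metric.mem_closedBall, Real.dist_eq, add_sub_cancel_left]
      exact hs.le)
    simp only [F, χ', this, add_sub_cancel_left, mul_one]
    module

/-- The `c^∞`-topology of a complete normed space is the norm topology. -/
theorem isOpen_of_forall_contDiff [CompleteSpace E] {O : Set E}
    (h : ∀ c : ℝ → E, ContDiff ℝ ∞ c → ∀ t, c t ∈ O → ∀ᶠ s in 𝓝 t, c s ∈ O) : IsOpen O := by
  obtain ⟨δ, t, hδ, ht, H⟩ := exists_special_curve E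
  rw [isOpen_iff_mem_nhds]
  intro y hy
  -- Otherwise points outside `O` approach `y` as fast as desired; a special curve through them
  -- starts in `O` and leaves it at times tending to `0`.
  by_contra hO
  have hz : ∀ k, ∃ z, ‖z - y‖ ≤ δ k ∧ z ∉ O := by
    intro k
    by_contra hcon
    push Not at hcon
    exact hO (mem_of_superset (Metric.ball_mem_nhds y (hδ k)) fun z hz =>
      hcon z (by rw [← dist_eq_norm]; exact (Metric.mem_ball.1 hz).le))
  choose z hz hzO using hz
  obtain ⟨c, hc, hc0, hck⟩ := H y z (fun _ => 0) hz (by simp)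
  obtain ⟨k, hk⟩ := (ht.eventually (h c hc 0 (by rwa [hc0]))).exists
  have := (hck k).self_of_nhds
  rw [add_zero, smul_zero, add_zero] at this
  exact hzO k (this ▸ hk)

end Analysis
-- A weak form of Boman's theorem.
section Boman

variable {E : Type*} [NormedAddCommGroup E] [NormedSpace ℝ E]

/-- A curve in an open set on which `g` is smooth along curves may leave the set. -/
theorem contDiffAt_comp_of_forall_curve {g : E → ℝ} {U : Set E} (hU : IsOpen U)
    (h : ∀ c : ℝ → E, ContDiff ℝ ∞ c → (∀ t, c t ∈ U) → ContDiff ℝ ∞ (g ∘ c))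
    {c : ℝ → E} (hc : ContDiff ℝ ∞ c) {t : ℝ} (ht : c t ∈ U) : ContDiffAt ℝ ∞ (g ∘ c) t := by
  -- Reparametrizing by `θ` keeps the whole curve in `U` without changing its germ at `t`.
  obtain ⟨θ, hθ, hθt, hθU⟩ := exists_contDiff_eventuallyEq_id
    (hc.continuous.continuousAt.preimage_mem_nhds (hU.mem_nhds ht))
  refine (h (c ∘ θ) (hc.comp hθ) hθU).contDiffAt.congr_of_eventuallyEq ?_
  filter_upwards [hθt] with s hs
  simp [hs]

/-- The second derivative of `s ↦ g (z + s • v)` at `0`. -/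
noncomputable def lineDeriv₂ (g : E → ℝ) (z v : E) : ℝ :=
  deriv (deriv fun s : ℝ => g (z + s • v)) 0

theorem deriv_line (g : E → ℝ) (z v : E) (t : ℝ) :
    deriv (fun s : ℝ => g (z + s • v)) t = lineDeriv ℝ g (z + t • v) v := by
  have h := deriv_comp_const_add (fun s : ℝ => g (z + s • v)) t 0
  rw [add_zero] at h
  rw [← h, lineDeriv]
  simp only [add_smul, add_assoc]

theorem deriv_deriv_line (g : E → ℝ) (z v : E) (t : ℝ) :
    deriv (deriv fun s : ℝ => g (z + s • v)) t = lineDeriv₂ g (z + t • v) v := by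
  have h := deriv_comp_const_add (deriv fun s : ℝ => g (z + s • v)) t 0
  rw [add_zero] at h
  rw [← h, lineDeriv₂]
  congr 1
  funext s
  rw [deriv_line, deriv_line, add_smul, add_assoc]

theorem deriv_deriv_comp_mul_left (f : ℝ → ℝ) (a : ℝ) :
    deriv (deriv fun s => f (a * s)) 0 = a ^ 2 * deriv (deriv f) 0 := by
  have h : (deriv fun s => f (a * s)) = fun s => a * deriv f (a * s) := by
    funext s
    rw [deriv_comp_mul_left, smul_eq_mul]
  rw [h, deriv_const_mul_field, deriv_comp_mul_left, smul_eq_mul, mul_zero]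
  ring

theorem lineDeriv₂_smul (g : E → ℝ) (z v : E) (a : ℝ) :
    lineDeriv₂ g z (a • v) = a ^ 2 * lineDeriv₂ g z v := by
  have h := deriv_deriv_comp_mul_left (fun s : ℝ => g (z + s • v)) a
  rw [lineDeriv₂, lineDeriv₂, ← h]
  simp only [smul_smul, mul_comm]

/-- The second directional derivatives of a function that is smooth along curves are locally
bounded. -/
theorem exists_lineDeriv₂_bound [CompleteSpace E] {g : E → ℝ} {U : Set E} (hU : IsOpen U)
    (h : ∀ c : ℝ → E, ContDiff ℝ ∞ c → (∀ t, c t ∈ U) → ContDiff ℝ ∞ (g ∘ c))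
    {y : E} (hy : y ∈ U) : ∃ C ε : ℝ, 0 ≤ C ∧ 0 < ε ∧ Metric.ball y ε ⊆ U ∧
      ∀ z ∈ Metric.ball y ε, ∀ v, |lineDeriv₂ g z v| ≤ C * ‖v‖ ^ 2 := by
  suffices H : ∃ C ε : ℝ, 0 ≤ C ∧ 0 < ε ∧ Metric.ball y ε ⊆ U ∧
      ∀ z ∈ Metric.ball y ε, ∀ v, ‖v‖ ≤ 1 → |lineDeriv₂ g z v| ≤ C by
    obtain ⟨C, ε, hC, hε, hb, H⟩ := H
    refine ⟨C, ε, hC, hε, hb, fun z hz v => ?_⟩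
    rcases eq_or_ne v 0 with rfl | hv
    · simp [lineDeriv₂]
    · have hn : ‖v‖ ≠ 0 := norm_ne_zero_iff.2 hv
      have := H z hz (‖v‖⁻¹ • v) (by simp [norm_smul, hn])
      have e : v = ‖v‖ • ‖v‖⁻¹ • v := by rw [smul_smul, mul_inv_cancel₀ hn, one_smul]
      conv_lhs => rw [e]
      rw [lineDeriv₂_smul, abs_mul, abs_of_nonneg (sq_nonneg _), mul_comm]
      gcongr
  obtain ⟨δ, t, hδ, ht, H⟩ := exists_special_curve E
  obtain ⟨ε₀, hε₀, hb₀⟩ := Metric.isOpen_iff.1 hU y hy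
  by_contra hcon
  push Not at hcon
  -- The special curve passes `z k` with velocity `δ k • v k`, so second derivatives along it carry
  -- the factor `δ k ^ 2`. Exceeding `k / δ k ^ 2` makes them exceed `k` at times tending to `0`,
  -- against continuity.
  have hz : ∀ k : ℕ, ∃ z ∈ Metric.ball y (min ε₀ (δ k)), ∃ v, ‖v‖ ≤ 1 ∧
      (k : ℝ) / δ k ^ 2 < |lineDeriv₂ g z v| := fun k =>
    hcon ((k : ℝ) / δ k ^ 2) _ (by positivity) (lt_min hε₀ (hδ k))
      ((Metric.ball_subset_ball (min_le_left _ _)).trans hb₀)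
  choose z hzb v hv hzv using hz
  obtain ⟨c, hc, hc0, hck⟩ := H y z v (fun k => by
    have := hzb k
    rw [Metric.mem_ball, dist_eq_norm] at this
    exact (this.trans_le (min_le_right _ _)).le) hv
  obtain ⟨θ, hθ, hθ0, hθU⟩ := exists_contDiff_eventuallyEq_id (x := (0 : ℝ))
    (hc.continuous.continuousAt.preimage_mem_nhds (hU.mem_nhds (by rwa [hc0])))
  let G : ℝ → ℝ := g ∘ c ∘ θ
  have hG : ContDiff ℝ ∞ G := h _ (hc.comp hθ) hθU
  have hcont : Continuous (deriv (deriv G)) :=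
    (contDiff_infty_iff_deriv.1 (contDiff_infty_iff_deriv.1 hG).2).2.continuous
  have hval : ∀ᶠ k : ℕ in atTop, (k : ℝ) < |deriv (deriv G) (t k)| := by
    filter_upwards [ht.eventually hθ0.eventuallyEq_nhds] with k hk
    have e1 : (fun s => G (t k + s)) =ᶠ[𝓝 0] fun s => g (z k + (δ k * s) • v k) := by
      have ht' : Tendsto (fun s => t k + s) (𝓝 0) (𝓝 (t k)) := by
        have hcont : Continuous fun s => t k + s := by fun_prop
        simpa using hcont.tendsto 0
      filter_upwards [hck k, ht'.eventually hk] with s hs hs'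
      simp only [G, Function.comp_apply, hs', id, hs]
    have e2 : deriv (deriv G) (t k) = δ k ^ 2 * lineDeriv₂ g (z k) (v k) := by
      have a1 := deriv_comp_const_add (deriv G) (t k) 0
      rw [add_zero] at a1
      have a2 : (fun s => deriv G (t k + s)) = deriv fun s => G (t k + s) :=
        funext fun s => (deriv_comp_const_add G (t k) s).symm
      rw [← a1, a2, e1.deriv.deriv_eq,
        deriv_deriv_comp_mul_left (fun s => g (z k + s • v k)) (δ k), lineDeriv₂]
    have := hzv k
    have hδk := hδ k
    rw [div_lt_iff₀ (by positivity)] at this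
    rw [e2, abs_mul, abs_of_pos (by positivity), mul_comm]
    exact this
  have hlim := ((hcont.tendsto 0).comp ht).abs
  obtain ⟨m, hm⟩ := exists_nat_gt (|deriv (deriv G) 0|)
  obtain ⟨k, hk1, hk2, hk3⟩ := (hval.and ((hlim.eventually (gt_mem_nhds hm)).and
    (eventually_ge_atTop m))).exists
  have : (m : ℝ) ≤ k := by exact_mod_cast hk3
  simp only [Function.comp_apply] at hk2
  linarith

/-- Taylor's inequality along a segment. -/
theorem abs_sub_sub_lineDeriv_le {g : E → ℝ} {U : Set E} (hU : IsOpen U)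
    (h : ∀ c : ℝ → E, ContDiff ℝ ∞ c → (∀ t, c t ∈ U) → ContDiff ℝ ∞ (g ∘ c))
    {y : E} {C ε : ℝ} (hb : Metric.ball y ε ⊆ U) (hC : 0 ≤ C)
    (H : ∀ z ∈ Metric.ball y ε, ∀ v, |lineDeriv₂ g z v| ≤ C * ‖v‖ ^ 2)
    {z w : E} (hz : z ∈ Metric.ball y (ε / 2)) (hw : ‖w‖ < ε / 2) :
    |g (z + w) - g z - lineDeriv ℝ g z w| ≤ C * ‖w‖ ^ 2 := by
  let r : ℝ → ℝ := fun s => g (z + s • w)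
  have hmem : ∀ s ∈ Set.Icc (0 : ℝ) 1, z + s • w ∈ Metric.ball y ε := by
    intro s hs
    rw [Metric.mem_ball, dist_eq_norm] at hz ⊢
    calc ‖z + s • w - y‖ = ‖(z - y) + s • w‖ := by congr 1; abel
      _ ≤ ‖z - y‖ + |s| * ‖w‖ := (norm_add_le _ _).trans (by rw [norm_smul, Real.norm_eq_abs])
      _ ≤ ‖z - y‖ + 1 * ‖w‖ := by
          gcongr
          rw [abs_of_nonneg hs.1]
          exact hs.2
      _ < ε := by linarith
  have hr : ∀ s ∈ Set.Icc (0 : ℝ) 1, ContDiffAt ℝ ∞ r s := fun s hs =>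
    contDiffAt_comp_of_forall_curve hU h
      (contDiff_const.add (contDiff_id.smul contDiff_const)) (hb (hmem s hs))
  have hr' : ∀ s ∈ Set.Icc (0 : ℝ) 1, DifferentiableAt ℝ (deriv r) s := fun s hs =>
    ((hr s hs).derivWithin (m := ∞) (by simp)).differentiableAt (by simp)
  have hr1 : ∀ s ∈ Set.Icc (0 : ℝ) 1, DifferentiableAt ℝ r s := fun s hs =>
    (hr s hs).differentiableAt (by simp)
  have b1 : ∀ s ∈ Set.Icc (0 : ℝ) 1, |deriv r s - deriv r 0| ≤ C * ‖w‖ ^ 2 := by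
    intro s hs
    have := (convex_Icc (0 : ℝ) 1).norm_image_sub_le_of_norm_deriv_le (f := deriv r)
      (C := C * ‖w‖ ^ 2) hr' (fun x hx => by
        rw [Real.norm_eq_abs, deriv_deriv_line]
        exact H _ (hmem x hx) w) (Set.left_mem_Icc.2 zero_le_one) hs
    rw [Real.norm_eq_abs, sub_zero, Real.norm_eq_abs, abs_of_nonneg hs.1] at this
    exact this.trans (mul_le_of_le_one_right (by positivity) hs.2)
  have hd : ∀ s ∈ Set.Icc (0 : ℝ) 1,
      HasDerivAt (fun s => r s - s * deriv r 0) (deriv r s - deriv r 0) s := fun s hs => by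
    simpa [Function.comp_def, Pi.sub_def] using
      (hr1 s hs).hasDerivAt.sub ((hasDerivAt_id s).mul_const (deriv r 0))
  have b2 := (convex_Icc (0 : ℝ) 1).norm_image_sub_le_of_norm_deriv_le
    (f := fun s => r s - s * deriv r 0) (C := C * ‖w‖ ^ 2)
    (fun s hs => (hd s hs).differentiableAt) (fun s hs => by
      rw [(hd s hs).deriv, Real.norm_eq_abs]
      exact b1 s hs) (Set.left_mem_Icc.2 zero_le_one) (Set.right_mem_Icc.2 zero_le_one)
  have e : deriv r 0 = lineDeriv ℝ g z w := rfl
  simp only [e, r, one_smul, zero_smul, add_zero, one_mul, zero_mul, sub_zero, Real.norm_eq_abs,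
    norm_one, mul_one] at b2
  convert b2 using 2
  ring

/-- A weak form of Boman's theorem: a function that is smooth along smooth curves is of
class `C¹`. -/
theorem contDiffOn_one_of_forall_curve [FiniteDimensional ℝ E] {g : E → ℝ} {U : Set E}
    (hU : IsOpen U)
    (h : ∀ c : ℝ → E, ContDiff ℝ ∞ c → (∀ t, c t ∈ U) → ContDiff ℝ ∞ (g ∘ c)) :
    ContDiffOn ℝ 1 g U := by
  have : CompleteSpace E := FiniteDimensional.complete ℝ E
  intro y hy
  refine ContDiffAt.contDiffWithinAt ?_
  obtain ⟨C, ε, hC, hε, hb, H⟩ := exists_lineDeriv₂_bound hU h hy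
  have T : ∀ {z w : E}, z ∈ Metric.ball y (ε / 2) → ‖w‖ < ε / 2 →
      |g (z + w) - g z - lineDeriv ℝ g z w| ≤ C * ‖w‖ ^ 2 := fun hz hw =>
    abs_sub_sub_lineDeriv_le hU h hb hC H hz hw
  have hadd : ∀ z ∈ Metric.ball y (ε / 4), ∀ v w,
      lineDeriv ℝ g z (v + w) = lineDeriv ℝ g z v + lineDeriv ℝ g z w := by
    intro z hz v w
    set n := ‖v‖ + ‖w‖ with hn
    have hn0 : 0 ≤ n := by positivity
    -- With `z + m` the common midpoint of the pairs `z`, `z + s(v + w)` and `z + sv`, `z + sw`,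
    -- four expansions at `z + m` compare the two sums of values, since directional derivatives are
    -- odd. Three expansions at `z` turn this into the claim; each of the seven costs `C (s n)²`.
    have key : ∀ s : ℝ, 0 < s → s * n < ε / 4 →
        |lineDeriv ℝ g z (v + w) - lineDeriv ℝ g z v - lineDeriv ℝ g z w| ≤
          s * (7 * (C * n ^ 2)) := by
      intro s hs hsn
      let m : E := (s / 2) • (v + w)
      let u : E := (s / 2) • (v - w)
      have nv : ‖s • v‖ ≤ s * n := by
        rw [norm_smul, Real.norm_eq_abs, abs_of_pos hs]
        gcongr
        linarith [norm_nonneg w]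
      have nw : ‖s • w‖ ≤ s * n := by
        rw [norm_smul, Real.norm_eq_abs, abs_of_pos hs]
        gcongr
        linarith [norm_nonneg v]
      have nvw : ‖s • (v + w)‖ ≤ s * n := by
        rw [norm_smul, Real.norm_eq_abs, abs_of_pos hs]
        gcongr
        exact norm_add_le _ _
      have nm : ‖m‖ ≤ s * n := by
        rw [norm_smul, Real.norm_eq_abs, abs_of_pos (by positivity)]
        have := norm_add_le v w
        have : s / 2 * ‖v + w‖ ≤ s / 2 * n := by gcongr
        nlinarith
      have nu : ‖u‖ ≤ s * n := by
        rw [norm_smul, Real.norm_eq_abs, abs_of_pos (by positivity)]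
        have := norm_sub_le v w
        have : s / 2 * ‖v - w‖ ≤ s / 2 * n := by gcongr
        nlinarith
      have hz2 : z ∈ Metric.ball y (ε / 2) := Metric.ball_subset_ball (by linarith) hz
      have hzm : z + m ∈ Metric.ball y (ε / 2) := by
        rw [Metric.mem_ball, dist_eq_norm] at hz ⊢
        calc ‖z + m - y‖ = ‖(z - y) + m‖ := by congr 1; abel
          _ ≤ ‖z - y‖ + ‖m‖ := norm_add_le _ _
          _ < ε / 2 := by linarith
      have hsq : ∀ {x : E}, ‖x‖ ≤ s * n → C * ‖x‖ ^ 2 ≤ C * (s * n) ^ 2 := fun hx => by gcongr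
      have neg : ∀ x, lineDeriv ℝ g (z + m) (-x) = -lineDeriv ℝ g (z + m) x := fun x => by
        rw [← neg_one_smul ℝ x, lineDeriv_smul, smul_eq_mul]; ring
      have t1 := (T hz2 (nvw.trans_lt (by linarith))).trans (hsq nvw)
      have t2 := (T hz2 (nv.trans_lt (by linarith))).trans (hsq nv)
      have t3 := (T hz2 (nw.trans_lt (by linarith))).trans (hsq nw)
      have t4 := (T hzm (nm.trans_lt (by linarith))).trans (hsq nm)
      have t5 := (T hzm ((norm_neg m).trans_le nm |>.trans_lt (by linarith))).trans
        (hsq ((norm_neg m).trans_le nm))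
      have t6 := (T hzm (nu.trans_lt (by linarith))).trans (hsq nu)
      have t7 := (T hzm ((norm_neg u).trans_le nu |>.trans_lt (by linarith))).trans
        (hsq ((norm_neg u).trans_le nu))
      have e4 : z + m + m = z + s • (v + w) := by simp only [m]; module
      have e5 : z + m + -m = z := by abel
      have e6 : z + m + u = z + s • v := by simp only [m, u]; module
      have e7 : z + m + -u = z + s • w := by simp only [m, u]; module
      rw [e4] at t4
      rw [e5, neg] at t5
      rw [e6] at t6
      rw [e7, neg] at t7
      rw [lineDeriv_smul, smul_eq_mul] at t1 t2 t3
      rw [abs_le] at t1 t2 t3 t4 t5 t6 t7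
      refine le_of_mul_le_mul_left (a := s) ?_ hs
      rw [← abs_of_pos hs, ← abs_mul, abs_of_pos hs, abs_le]
      constructor <;> nlinarith
    have hq : |lineDeriv ℝ g z (v + w) - lineDeriv ℝ g z v - lineDeriv ℝ g z w| ≤ 0 := by
      have hlim : Tendsto (fun s : ℝ => s * (7 * (C * n ^ 2))) (𝓝[>] 0) (𝓝 0) := by
        have : Continuous fun s : ℝ => s * (7 * (C * n ^ 2)) := by fun_prop
        simpa using (this.tendsto 0).mono_left nhdsWithin_le_nhds
      have hlim' : Tendsto (fun s : ℝ => s * n) (𝓝[>] 0) (𝓝 0) := by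
        have : Continuous fun s : ℝ => s * n := by fun_prop
        simpa using (this.tendsto 0).mono_left nhdsWithin_le_nhds
      refine ge_of_tendsto hlim ?_
      filter_upwards [self_mem_nhdsWithin,
        hlim'.eventually (gt_mem_nhds (show (0 : ℝ) < ε / 4 by positivity))] with s hs hs'
      exact key s hs hs'
    have := abs_nonpos_iff.1 hq
    linarith
  -- The value `0` off the ball is a dummy.
  let D : E → E →L[ℝ] ℝ := fun z => by
    classical
    exact if hz : z ∈ Metric.ball y (ε / 4) then
      LinearMap.toContinuousLinearMap
        { toFun := lineDeriv ℝ g z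
          map_add' := hadd z hz
          map_smul' := fun a v => lineDeriv_smul }
    else 0
  have hD : ∀ z ∈ Metric.ball y (ε / 4), ∀ v, D z v = lineDeriv ℝ g z v := by
    intro z hz v
    simp only [D, dif_pos hz]
    rfl
  have hfd : ∀ z ∈ Metric.ball y (ε / 4), HasFDerivAt g (D z) z := by
    intro z hz
    rw [hasFDerivAt_iff_isLittleO_nhds_zero]
    refine Asymptotics.IsBigO.trans_isLittleO ?_ (Asymptotics.isLittleO_norm_pow_id one_lt_two)
    refine Asymptotics.IsBigO.of_bound C ?_
    filter_upwards [Metric.ball_mem_nhds (0 : E) (show 0 < ε / 2 by positivity)] with w hw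
    rw [mem_ball_zero_iff] at hw
    rw [hD z hz, Real.norm_eq_abs, Real.norm_eq_abs (‖w‖ ^ 2), abs_of_nonneg (sq_nonneg ‖w‖)]
    exact T (Metric.ball_subset_ball (by linarith) hz) hw
  refine contDiffAt_one_iff.2 ⟨D, Metric.ball y (ε / 8), Metric.ball_mem_nhds y (by positivity), ?_,
    fun z hz => hfd z (Metric.ball_subset_ball (by linarith) hz)⟩
  refine continuousOn_clm_apply.2 fun v z₀ hz₀ => ContinuousAt.continuousWithinAt ?_
  have hsub : ∀ z ∈ Metric.ball y (ε / 8), z ∈ Metric.ball y (ε / 4) := fun z hz =>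
    Metric.ball_subset_ball (by linarith) hz
  rw [Metric.continuousAt_iff']
  intro η hη
  have hlim : Tendsto (fun s : ℝ => s * (2 * (C * ‖v‖ ^ 2))) (𝓝[>] 0) (𝓝 0) := by
    have : Continuous fun s : ℝ => s * (2 * (C * ‖v‖ ^ 2)) := by fun_prop
    simpa using (this.tendsto 0).mono_left nhdsWithin_le_nhds
  have hlim' : Tendsto (fun s : ℝ => s * ‖v‖) (𝓝[>] 0) (𝓝 0) := by
    have : Continuous fun s : ℝ => s * ‖v‖ := by fun_prop
    simpa using (this.tendsto 0).mono_left nhdsWithin_le_nhds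
  -- One step `s` serves all `z` near `z₀`: the quotient `(g (z + s • v) - g z) / s` is continuous
  -- in `z` and within `s C ‖v‖²` of `D z v`. The two Taylor errors and the two continuity errors of
  -- `s η / 4` each contribute at most `s η / 2` in total.
  obtain ⟨s, hs1, hs2, hs⟩ :=
    ((hlim.eventually (gt_mem_nhds (show (0 : ℝ) < η / 2 by positivity))).and
    ((hlim'.eventually (gt_mem_nhds (show (0 : ℝ) < ε / 8 by positivity))).and
      self_mem_nhdsWithin)).exists
  have hs : 0 < s := hs
  have nv : ‖s • v‖ = s * ‖v‖ := by rw [norm_smul, Real.norm_eq_abs, abs_of_pos hs]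
  have c1 : ContinuousAt g z₀ := (hfd z₀ (hsub _ hz₀)).continuousAt
  have c2 : ContinuousAt (fun z => g (z + s • v)) z₀ := by
    have : z₀ + s • v ∈ Metric.ball y (ε / 4) := by
      rw [Metric.mem_ball, dist_eq_norm] at hz₀ ⊢
      calc ‖z₀ + s • v - y‖ = ‖(z₀ - y) + s • v‖ := by congr 1; abel
        _ ≤ ‖z₀ - y‖ + ‖s • v‖ := norm_add_le _ _
        _ < ε / 4 := by rw [nv]; linarith
    exact ContinuousAt.comp (f := fun z => z + s • v) (hfd _ this).continuousAt (by fun_prop)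
  have hη' : 0 < s * η / 4 := by positivity
  filter_upwards [Metric.continuousAt_iff'.1 c1 _ hη', Metric.continuousAt_iff'.1 c2 _ hη',
    Metric.isOpen_ball.mem_nhds hz₀] with z h1 h2 hz
  have t1 := T (w := s • v) (Metric.ball_subset_ball (by linarith) hz) (by rw [nv]; linarith)
  have t2 := T (w := s • v) (Metric.ball_subset_ball (by linarith) hz₀) (by rw [nv]; linarith)
  rw [hD z (hsub z hz), hD z₀ (hsub z₀ hz₀), Real.dist_eq]
  rw [Real.dist_eq, abs_lt] at h1 h2
  rw [lineDeriv_smul, smul_eq_mul, abs_le, nv] at t1 t2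
  refine lt_of_mul_lt_mul_left (a := s) ?_ hs.le
  rw [← abs_of_pos hs, ← abs_mul, abs_of_pos hs, abs_lt]
  have := mul_lt_mul_of_pos_left hs1 hs
  constructor <;> nlinarith

end Boman
-- Calculus of smooth curves in topological vector spaces.
section CurveCalculus

variable {E : Type*} [AddCommGroup E] [Module ℝ E] [TopologicalSpace E]

theorem HasVelocityAt.congr {c c' : ℝ → E} {v : E} {t : ℝ} (h : HasVelocityAt c v t)
    (hc : c =ᶠ[𝓝 t] c') : HasVelocityAt c' v t := by
  have ht : Tendsto (fun s => t + s) (𝓝[≠] 0) (𝓝 t) := by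
    have : Continuous fun s => t + s := by fun_prop
    simpa using (this.tendsto 0).mono_left nhdsWithin_le_nhds
  refine Tendsto.congr' ?_ h
  filter_upwards [ht.eventually hc] with s hs
  rw [hs, hc.eq_of_nhds]

theorem HasVelocityAt.unique [T2Space E] {c : ℝ → E} {v w : E} {t : ℝ} (h : HasVelocityAt c v t)
    (h' : HasVelocityAt c w t) : v = w :=
  tendsto_nhds_unique h h'

/-- Coinduction principle for smooth curves. -/
theorem SmoothCurve.of_forall_exists_velocity (P : (ℝ → E) → Prop)
    (hP : ∀ c, P c → ∃ c', P c' ∧ ∀ t, HasVelocityAt c (c' t) t) {c : ℝ → E} (hc : P c) :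
    SmoothCurve c := by
  choose f hf using fun c : {c // P c} => hP c.1 c.2
  let F : {c // P c} → {c // P c} := fun c => ⟨f c, (hf c).1⟩
  refine ⟨fun k => (F^[k] ⟨c, hc⟩).1, rfl, fun k t => ?_⟩
  have h := (hf (F^[k] ⟨c, hc⟩)).2 t
  rwa [show f (F^[k] ⟨c, hc⟩) = (F^[k + 1] ⟨c, hc⟩).1 by rw [Function.iterate_succ_apply']] at h

theorem SmoothCurve.exists_velocity {c : ℝ → E} (hc : SmoothCurve c) :
    ∃ c', SmoothCurve c' ∧ ∀ t, HasVelocityAt c (c' t) t := by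
  obtain ⟨D, rfl, hD⟩ := hc
  exact ⟨D 1, ⟨fun k => D (k + 1), rfl, fun k => hD (k + 1)⟩, hD 0⟩

/-- Smoothness of curves is a local property. -/
theorem SmoothCurve.of_locally [T2Space E] {c : ℝ → E}
    (h : ∀ t, ∃ e, SmoothCurve e ∧ c =ᶠ[𝓝 t] e) : SmoothCurve c := by
  refine SmoothCurve.of_forall_exists_velocity
    (fun c => ∀ t, ∃ e, SmoothCurve e ∧ c =ᶠ[𝓝 t] e) ?_ h
  intro c hc
  choose e he hce using hc
  choose e' he' hv using fun t => (he t).exists_velocity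
  have hvc : ∀ t, ∀ᶠ s in 𝓝 t, HasVelocityAt c (e' t s) s := fun t => by
    filter_upwards [(hce t).eventuallyEq_nhds] with s hs
    exact (hv t s).congr hs.symm
  refine ⟨fun t => e' t t, fun t => ⟨e' t, he' t, ?_⟩, fun t => (hvc t).self_of_nhds⟩
  filter_upwards [hvc t] with s hs
  exact (hvc s).self_of_nhds.unique hs

theorem HasVelocityAt.clm_comp {F : Type*} [AddCommGroup F] [Module ℝ F] [TopologicalSpace F]
    (ℓ : E →L[ℝ] F) {c : ℝ → E} {v : E} {t : ℝ} (h : HasVelocityAt c v t) :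
    HasVelocityAt (ℓ ∘ c) (ℓ v) t := by
  have := (ℓ.continuous.tendsto v).comp h
  refine this.congr fun s => ?_
  simp

theorem SmoothCurve.clm_comp {F : Type*} [AddCommGroup F] [Module ℝ F] [TopologicalSpace F]
    (ℓ : E →L[ℝ] F) {c : ℝ → E} (hc : SmoothCurve c) : SmoothCurve (ℓ ∘ c) := by
  obtain ⟨D, rfl, hD⟩ := hc
  exact ⟨fun k => ℓ ∘ D k, rfl, fun k t => (hD k t).clm_comp ℓ⟩

variable [IsTopologicalAddGroup E]

theorem HasVelocityAt.add {c c' : ℝ → E} {v w : E} {t : ℝ} (h : HasVelocityAt c v t)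
    (h' : HasVelocityAt c' w t) : HasVelocityAt (c + c') (v + w) t := by
  refine (Tendsto.add h h').congr fun s => ?_
  simp only [Pi.add_apply, ← smul_add]
  congr 1
  abel

theorem SmoothCurve.add {c c' : ℝ → E} (h : SmoothCurve c) (h' : SmoothCurve c') :
    SmoothCurve (c + c') := by
  obtain ⟨D, rfl, hD⟩ := h
  obtain ⟨D', rfl, hD'⟩ := h'
  exact ⟨fun k => D k + D' k, rfl, fun k t => (hD k t).add (hD' k t)⟩

theorem SmoothCurve.sum {ι : Type*} (s : Finset ι) {c : ι → ℝ → E}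
    (h : ∀ i ∈ s, SmoothCurve (c i)) : SmoothCurve (∑ i ∈ s, c i) := by
  classical
  induction s using Finset.induction_on with
  | empty => exact smoothCurve_const 0
  | insert i s hi ih =>
    rw [Finset.sum_insert hi]
    exact (h i (Finset.mem_insert_self i s)).add
      (ih fun j hj => h j (Finset.mem_insert_of_mem hj))

variable [ContinuousSMul ℝ E]

/-- The product and the chain rule for curves in a topological vector space. -/
theorem HasVelocityAt.smul_comp {a θ : ℝ → ℝ} {a' θ' : ℝ} {e : ℝ → E} {v : E} {t : ℝ}
    (ha : HasDerivAt a a' t) (hθ : HasDerivAt θ θ' t) (he : HasVelocityAt e v (θ t)) :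
    HasVelocityAt (fun s => a s • e (θ s)) (a' • e (θ t) + (a t * θ') • v) t := by
  classical
  have ht : Tendsto (fun s => t + s) (𝓝[≠] 0) (𝓝 t) := by
    have : Continuous fun s => t + s := by fun_prop
    simpa using (this.tendsto 0).mono_left nhdsWithin_le_nhds
  -- Extending the difference quotient by `v` at `0` makes `e (θ t + u) - e (θ t) = u • Q u` valid
  -- also for `u = 0`, so increments of `θ` may vanish.
  let Q : ℝ → E := Function.update (fun u => u⁻¹ • (e (θ t + u) - e (θ t))) 0 v
  have hQ : Tendsto Q (𝓝 0) (𝓝 v) := by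
    have := continuousAt_update_same.2 he
    simpa [ContinuousAt] using this
  have hQe : ∀ u, e (θ t + u) - e (θ t) = u • Q u := by
    intro u
    by_cases hu : u = 0
    · simp [hu]
    · simp only [Q, Function.update_of_ne hu]
      rw [smul_smul, mul_inv_cancel₀ hu, one_smul]
  have hΔ : Tendsto (fun s => θ (t + s) - θ t) (𝓝[≠] 0) (𝓝 0) := by
    have := (hθ.continuousAt.tendsto.comp ht).sub_const (θ t)
    simpa using this
  have h1 := hasDerivAt_iff_tendsto_slope_zero.1 hθ
  have h2 := hasDerivAt_iff_tendsto_slope_zero.1 ha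
  have h3 : Tendsto (fun s => a (t + s)) (𝓝[≠] 0) (𝓝 (a t)) := ha.continuousAt.tendsto.comp ht
  have h4 := (h2.smul_const (e (θ t))).add ((h3.mul h1).smul (hQ.comp hΔ))
  refine h4.congr fun s => ?_
  have := hQe (θ (t + s) - θ t)
  rw [add_sub_cancel] at this
  simp only [Function.comp_apply, smul_eq_mul]
  have e1 : (a (t + s) * (s⁻¹ * (θ (t + s) - θ t))) • Q (θ (t + s) - θ t) =
      (a (t + s) * s⁻¹) • (e (θ (t + s)) - e (θ t)) := by
    rw [this, smul_smul, mul_assoc]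
  rw [e1]
  module

/-- Linear combinations with smooth coefficients of reparametrized smooth curves. -/
inductive SmoothCombination (θ : ℝ → ℝ) : (ℝ → E) → Prop
  | smul {a : ℝ → ℝ} {e : ℝ → E} (ha : ContDiff ℝ ∞ a) (he : SmoothCurve e) :
    SmoothCombination θ fun t => a t • e (θ t)
  | add {c c' : ℝ → E} (h : SmoothCombination θ c) (h' : SmoothCombination θ c') :
    SmoothCombination θ (c + c')

theorem SmoothCurve.smul_comp {a θ : ℝ → ℝ} {e : ℝ → E} (ha : ContDiff ℝ ∞ a)
    (hθ : ContDiff ℝ ∞ θ) (he : SmoothCurve e) : SmoothCurve fun t => a t • e (θ t) := by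
  -- By the product and chain rules, the velocity of a combination is again a combination, so the
  -- coinduction principle applies to this class.
  refine SmoothCurve.of_forall_exists_velocity (SmoothCombination θ) ?_ (.smul ha he)
  intro c hc
  induction hc with
  | @smul a e ha he =>
    obtain ⟨e', he', hv⟩ := he.exists_velocity
    have ha' := contDiff_infty_iff_deriv.1 ha
    have hθ' := contDiff_infty_iff_deriv.1 hθ
    exact ⟨_, .add (.smul ha'.2 he) (.smul (ha.mul hθ'.2) he'), fun t =>
      HasVelocityAt.smul_comp (ha'.1 t).hasDerivAt (hθ'.1 t).hasDerivAt (hv (θ t))⟩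
  | add _ _ ih ih' =>
    obtain ⟨c₁, h₁, hv₁⟩ := ih
    obtain ⟨c₂, h₂, hv₂⟩ := ih'
    exact ⟨_, .add h₁ h₂, fun t => (hv₁ t).add (hv₂ t)⟩

theorem SmoothCurve.comp_contDiff {θ : ℝ → ℝ} {e : ℝ → E} (he : SmoothCurve e)
    (hθ : ContDiff ℝ ∞ θ) : SmoothCurve (e ∘ θ) := by
  simpa [Function.comp_def] using SmoothCurve.smul_comp (a := fun _ => 1) contDiff_const hθ he

theorem SmoothCurve.smul_const {a : ℝ → ℝ} (ha : ContDiff ℝ ∞ a) (w : E) :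
    SmoothCurve fun t => a t • w :=
  SmoothCurve.smul_comp ha contDiff_id (smoothCurve_const w)

/-- Smoothness hypotheses concern curves that stay in a set for all time; this makes them applicable
to a curve that is known to stay there only near `t`. -/
theorem SmoothCurve.exists_retract {c : ℝ → E} (hc : SmoothCurve c) {t : ℝ} {O : Set ℝ}
    (hO : O ∈ 𝓝 t) : ∃ θ : ℝ → ℝ, ContDiff ℝ ∞ θ ∧ θ =ᶠ[𝓝 t] id ∧ (∀ s, θ s ∈ O) ∧
      SmoothCurve (c ∘ θ) ∧ c ∘ θ =ᶠ[𝓝 t] c := by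
  obtain ⟨θ, hθ, hθt, hθO⟩ := exists_contDiff_eventuallyEq_id hO
  exact ⟨θ, hθ, hθt, hθO, hc.comp_contDiff hθ, hθt.fun_comp c⟩

end CurveCalculus
-- Smooth curves in manifolds, and their detection of plots and smooth maps.
namespace Manifold

variable {M : Type*} {N : Type*}

/-- Smooth curves in a manifold. -/
def IsSmoothCurve (A : Manifold M) (c : ℝ → M) : Prop :=
  ∀ t, ∀ φ ∈ A.atlas, c t ∈ φ.equiv.source →
    ∃ e : ℝ → φ.model, SmoothCurve e ∧ ∀ᶠ s in 𝓝 t, c s ∈ φ.equiv.source ∧ φ.equiv (c s) = e s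

variable {A : Manifold M} {B : Manifold N}

theorem IsSmoothCurve.comp_contDiff {c : ℝ → M} (hc : A.IsSmoothCurve c) {θ : ℝ → ℝ}
    (hθ : ContDiff ℝ ∞ θ) : A.IsSmoothCurve (c ∘ θ) := by
  intro t φ hφ ht
  obtain ⟨e, he, h⟩ := hc (θ t) φ hφ ht
  exact ⟨e ∘ θ, he.comp_contDiff hθ, (hθ.continuous.tendsto t).eventually h⟩

theorem IsSmoothCurve.isOpen_preimage_source {c : ℝ → M} (hc : A.IsSmoothCurve c)
    {φ : Chart M} (hφ : φ ∈ A.atlas) : IsOpen (c ⁻¹' φ.equiv.source) := by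
  rw [isOpen_iff_mem_nhds]
  intro t ht
  obtain ⟨e, -, he⟩ := hc t φ hφ ht
  exact he.mono fun s hs => hs.1

theorem IsSmoothCurve.smoothCurve_chart {c : ℝ → M} (hc : A.IsSmoothCurve c)
    {φ : Chart M} (hφ : φ ∈ A.atlas) (h : ∀ t, c t ∈ φ.equiv.source) :
    SmoothCurve (φ.equiv ∘ c) :=
  SmoothCurve.of_locally fun t => by
    obtain ⟨e, he, hce⟩ := hc t φ hφ (h t)
    exact ⟨e, he, hce.mono fun s hs => hs.2⟩

/-- Seen from another chart, the curve stays near `t` in the `c^∞`-open overlap; after a cut-off it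
lies there entirely and the chart changing applies. -/
theorem isSmoothCurve_chart_symm {φ : Chart M} (hφ : φ ∈ A.atlas) {e : ℝ → φ.model}
    (he : SmoothCurve e) (h : ∀ t, e t ∈ φ.equiv.target) :
    A.IsSmoothCurve (φ.equiv.symm ∘ e) := by
  intro t ψ hψ ht
  set O := φ.equiv '' (φ.equiv.source ∩ ψ.equiv.source) with hO
  have hOo : IsOpen (e ⁻¹' O) :=
    isCInftyOpen_iff.1 (A.isCInftyOpen_overlap φ hφ ψ hψ) e he
  have htO : e t ∈ O :=
    ⟨φ.equiv.symm (e t), ⟨φ.equiv.map_target (h t), ht⟩, φ.equiv.right_inv (h t)⟩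
  obtain ⟨θ, hθ, hθt, hθO, hs, hst⟩ := he.exists_retract (hOo.mem_nhds htO)
  refine ⟨_, A.smoothOn_change φ hφ ψ hψ _ hs hθO, ?_⟩
  filter_upwards [hθt, hOo.mem_nhds htO] with s hs hsO
  obtain ⟨x, ⟨hx1, hx2⟩, hxs⟩ := hsO
  refine ⟨?_, ?_⟩
  · simp only [Function.comp_apply, ← hxs, φ.equiv.left_inv hx1]
    exact hx2
  · simp [hs]

theorem IsSmoothCurve.continuous {c : ℝ → M} (hc : A.IsSmoothCurve c) :
    Continuous[_, A.topology] c := by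
  refine @Continuous.mk _ _ _ A.topology _ fun W hW => ?_
  rw [isOpen_iff_mem_nhds]
  intro t ht
  obtain ⟨φ, hφ, htφ⟩ := A.exists_chart (c t)
  obtain ⟨e, he, hce⟩ := hc t φ hφ htφ
  have ho : IsOpen (e ⁻¹' (φ.equiv '' (φ.equiv.source ∩ W))) := isCInftyOpen_iff.1 (hW φ hφ) e he
  have hte : e t ∈ φ.equiv '' (φ.equiv.source ∩ W) := by
    rw [← hce.self_of_nhds.2]
    exact Set.mem_image_of_mem _ ⟨htφ, ht⟩
  filter_upwards [ho.mem_nhds hte, hce] with s hs hs'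
  obtain ⟨x, ⟨hx, hxW⟩, hxs⟩ := hs
  rw [← hs'.2] at hxs
  rw [Set.mem_preimage, ← φ.equiv.injOn hx hs'.1 hxs]
  exact hxW

/-- Two smooth curves in a separated manifold coincide on a closed set. -/
theorem isClosed_setOf_eq (hA : IsSeparated A.topology) {c c' : ℝ → M} (hc : A.IsSmoothCurve c)
    (hc' : A.IsSmoothCurve c') : IsClosed {t | c t = c' t} := by
  let _ := A.topology
  have h : Continuous fun t => (c t, c' t) :=
    (show Continuous c from hc.continuous).prodMk (show Continuous c' from hc'.continuous)
  -- The pair is itself one of the continuous curves defining the arc-generated topology.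
  have h' : Continuous[_, arcGenerated (instTopologicalSpaceProd)] fun t => (c t, c' t) := by
    rw [continuous_iff_coinduced_le]
    exact le_iSup (fun c : {c : ℝ → M × M // Continuous c} =>
      TopologicalSpace.coinduced c.1 inferInstance) ⟨_, h⟩
  exact @IsClosed.preimage _ _ _ (_) _ h' _ hA

/-- Maps of a normed space into a manifold that are smooth along smooth curves. -/
def SmoothAlongCurves (A : Manifold M) {X : Type*} [NormedAddCommGroup X] [NormedSpace ℝ X]
    (p : X → M) : Prop :=
  ∀ a : ℝ → X, ContDiff ℝ ∞ a → A.IsSmoothCurve (p ∘ a)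

section NormedSpace

variable {X : Type*} [NormedAddCommGroup X] [NormedSpace ℝ X] [FiniteDimensional ℝ X]

/-- In finite dimensions, smooth curves detect openness. -/
theorem SmoothAlongCurves.isOpen_preimage_source {p : X → M} (hp : A.SmoothAlongCurves p)
    {φ : Chart M} (hφ : φ ∈ A.atlas) : IsOpen (p ⁻¹' φ.equiv.source) := by
  have : CompleteSpace X := FiniteDimensional.complete ℝ X
  exact isOpen_of_forall_contDiff fun c hc t ht =>
    ((hp c hc).isOpen_preimage_source hφ).mem_nhds ht

theorem SmoothAlongCurves.contDiffOn_one {p : X → M} (hp : A.SmoothAlongCurves p)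
    {φ : Chart M} (hφ : φ ∈ A.atlas) (ℓ : φ.model →L[ℝ] ℝ) :
    ContDiffOn ℝ 1 (fun x => ℓ (φ.equiv (p x))) (p ⁻¹' φ.equiv.source) := by
  refine contDiffOn_one_of_forall_curve (hp.isOpen_preimage_source hφ) fun c hc hcs => ?_
  exact smoothCurve_iff_contDiff.1 (((hp c hc).smoothCurve_chart hφ hcs).clm_comp ℓ)

end NormedSpace

theorem isPlot_iff_smoothAlongCurves {n : ℕ} {p : EuclideanSpace ℝ (Fin n) → M} :
    @IsPlot M A.diffeology n p ↔ A.SmoothAlongCurves p := by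
  change A.IsParametrizationOn Set.univ p ↔ _
  constructor
  · intro hp a ha t φ hφ ht
    obtain ⟨W, hW, htW, -, hWφ, hs⟩ := hp (a t) trivial φ hφ ht
    obtain ⟨θ, hθ, hθt, hθW⟩ := exists_contDiff_eventuallyEq_id
      (ha.continuous.continuousAt.preimage_mem_nhds (hW.mem_nhds htW))
    refine ⟨_, hs (a ∘ θ) (smoothCurve_iff_contDiff.2 (ha.comp hθ)) hθW, ?_⟩
    filter_upwards [hθt, ha.continuous.continuousAt.preimage_mem_nhds (hW.mem_nhds htW)]
      with s hs hsW
    exact ⟨hWφ _ hsW, by simp [hs]⟩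
  · intro hp x _ φ hφ hx
    refine ⟨_, hp.isOpen_preimage_source hφ, hx, Set.subset_univ _, fun _ h => h, ?_⟩
    intro c hc hcW
    exact (hp c (smoothCurve_iff_contDiff.1 hc)).smoothCurve_chart hφ hcW

theorem isPlot_comp_coordinate_iff {c : ℝ → M} :
    @IsPlot M A.diffeology 1 (fun z => c (z 0)) ↔ A.IsSmoothCurve c := by
  rw [isPlot_iff_smoothAlongCurves]
  constructor
  · intro h
    have := h (fun t => EuclideanSpace.single 0 t)
      (contDiff_euclidean.2 fun i => by fin_cases i; exact contDiff_id)
    simpa [Function.comp_def] using this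
  · intro h a ha
    exact h.comp_contDiff (θ := fun t => a t 0) (by fun_prop)

theorem isSmooth_iff_forall_isSmoothCurve {f : M → N} :
    A.IsSmooth B f ↔ ∀ c, A.IsSmoothCurve c → B.IsSmoothCurve (f ∘ c) := by
  constructor
  · intro hf c hc t ψ hψ ht
    obtain ⟨φ, hφ, htφ, W, hW, htW, -, hWψ, hs⟩ := hf (c t) ψ hψ ht
    obtain ⟨e, he, hce⟩ := hc t φ hφ htφ
    rw [hce.self_of_nhds.2] at htW
    have hO := (isCInftyOpen_iff.1 hW e he).mem_nhds htW
    obtain ⟨θ, hθ, hθt, hθW, hsθ, -⟩ := he.exists_retract hO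
    refine ⟨_, hs _ hsθ hθW, ?_⟩
    filter_upwards [hθt, hO, hce] with s h1 h2 h3
    have h4 : φ.equiv.symm (e s) = c s := by rw [← h3.2, φ.equiv.left_inv h3.1]
    refine ⟨?_, ?_⟩
    · have := hWψ _ h2
      rwa [h4] at this
    · simp [h1, h4]
  · intro hf x ψ hψ hx
    -- Any chart at `x` works, with `W` the largest possible set; curves show that it is `c^∞`-open.
    obtain ⟨φ, hφ, hxφ⟩ := A.exists_chart x
    refine ⟨φ, hφ, hxφ, φ.equiv.target ∩ φ.equiv.symm ⁻¹' (f ⁻¹' ψ.equiv.source), ?_,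
      ⟨φ.equiv.map_source hxφ, ?_⟩, Set.inter_subset_left, fun y hy => hy.2, ?_⟩
    · rw [isCInftyOpen_iff]
      intro e he
      rw [isOpen_iff_mem_nhds]
      intro t ht
      have hO := (isCInftyOpen_iff.1 φ.isCInftyOpen_target e he).mem_nhds ht.1
      obtain ⟨θ, hθ, hθt, hθW, hsθ, -⟩ := he.exists_retract hO
      have hfc := hf _ (isSmoothCurve_chart_symm hφ hsθ hθW)
      have hts : t ∈ (f ∘ φ.equiv.symm ∘ e ∘ θ) ⁻¹' ψ.equiv.source := by
        simpa [hθt.eq_of_nhds] using ht.2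
      filter_upwards [hO, hθt, (hfc.isOpen_preimage_source hψ).mem_nhds hts] with s h1 h2 h3
      refine ⟨h1, ?_⟩
      simpa [h2] using h3
    · simpa [φ.equiv.left_inv hxφ] using hx
    · intro e he heW
      exact (hf _ (isSmoothCurve_chart_symm hφ he fun t => (heW t).1)).smoothCurve_chart hψ
        fun t => (heW t).2

end Manifold

/-! ### Skeletal diffeologies -/

section Skeleton

variable {X Y : Type*}

/-- A plot of the generated diffeology belongs to every diffeology containing the generators, and
`D` is one. The next lemmas apply the same principle to other diffeologies. -/
theorem isPlot_of_isPlot_skeleton {d n : ℕ} {D : DiffeologicalSpace X}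
    {p : EuclideanSpace ℝ (Fin n) → X} (hp : @IsPlot X (skeleton d D) n p) : @IsPlot X D n p :=
  hp D fun _ h => h.2

theorem isPlot_skeleton {d n : ℕ} {D : DiffeologicalSpace X} (hn : n ≤ d)
    {p : EuclideanSpace ℝ (Fin n) → X} (hp : @IsPlot X D n p) : @IsPlot X (skeleton d D) n p :=
  DiffeologicalSpace.isPlot_generatedFrom_of_mem ⟨hn, hp⟩

/-- The diffeology of the maps that become plots after composition with `f`. -/
@[reducible]
def comapDiffeology (f : X → Y) (D : DiffeologicalSpace Y) : DiffeologicalSpace X where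
  plots n := {p | @IsPlot Y D n (f ∘ p)}
  constant_plots x := D.constant_plots (f x)
  plot_reparam hp hf := D.plot_reparam hp hf
  locality hp := D.locality hp

theorem dSmooth_skeleton {d : ℕ} {DX : DiffeologicalSpace X} {DY : DiffeologicalSpace Y}
    {f : X → Y} (hf : @DSmooth X Y DX DY f) :
    @DSmooth X Y (skeleton d DX) (skeleton d DY) f := fun _ _ hp =>
  hp (comapDiffeology f (skeleton d DY)) fun _ hq => isPlot_skeleton hq.1 (hf _ _ hq.2)

/-- The diffeology of the maps that factor locally through plots of dimension `≤ d`. -/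
@[reducible]
def factorDiffeology (d : ℕ) (D : DiffeologicalSpace X) : DiffeologicalSpace X where
  plots n := {p | ∀ x, ∃ m ≤ d, ∃ (r : EuclideanSpace ℝ (Fin m) → X)
    (h : EuclideanSpace ℝ (Fin n) → EuclideanSpace ℝ (Fin m)),
    @IsPlot X D m r ∧ ContDiff ℝ ∞ h ∧ p =ᶠ[𝓝 x] r ∘ h}
  constant_plots y := fun _ => ⟨0, Nat.zero_le d, fun _ => y, fun _ => 0, D.constant_plots y,
    contDiff_const, EventuallyEq.rfl⟩
  plot_reparam {_ _ _ f} hp hf := fun x => by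
    obtain ⟨m, hm, r, h, hr, hh, hph⟩ := hp (f x)
    exact ⟨m, hm, r, h ∘ f, hr, hh.comp hf, hph.comp_tendsto (hf.continuous.tendsto x)⟩
  locality hp := fun x => by
    obtain ⟨U, hU, hxU, h⟩ := hp x
    -- The local hypothesis concerns reparametrizations with values in `U`; `θ` is one that is the
    -- identity near `x`.
    obtain ⟨θ, hθ, hθx, hθU⟩ := exists_contDiff_eventuallyEq_id (hU.mem_nhds hxU)
    obtain ⟨m, hm, r, g, hr, hg, hpg⟩ := h hθU hθ x
    refine ⟨m, hm, r, g, hr, hg, ?_⟩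
    filter_upwards [hθx, hpg] with z h1 h2
    simpa [h1] using h2

theorem exists_factorization_of_isPlot_skeleton {d n : ℕ} {D : DiffeologicalSpace X}
    {p : EuclideanSpace ℝ (Fin n) → X} (hp : @IsPlot X (skeleton d D) n p)
    (x : EuclideanSpace ℝ (Fin n)) : ∃ m ≤ d, ∃ (r : EuclideanSpace ℝ (Fin m) → X)
      (h : EuclideanSpace ℝ (Fin n) → EuclideanSpace ℝ (Fin m)),
      @IsPlot X D m r ∧ ContDiff ℝ ∞ h ∧ p =ᶠ[𝓝 x] r ∘ h :=
  hp (factorDiffeology d D) (fun q hq _ => ⟨q.1, hq.1, q.2, id, hq.2, contDiff_id,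
    EventuallyEq.rfl⟩) x

end Skeleton

/-! ### Part (1): smooth maps of manifolds, of diffeological spaces and of skeleta. -/

namespace Manifold

variable {M : Type*} {N : Type*} {A : Manifold M} {B : Manifold N}

theorem dSmooth_of_forall_isSmoothCurve {f : M → N}
    (hf : ∀ c, A.IsSmoothCurve c → B.IsSmoothCurve (f ∘ c)) :
    @DSmooth M N A.diffeology B.diffeology f := fun n p hp => by
  rw [isPlot_iff_smoothAlongCurves] at hp ⊢
  exact fun a ha => hf _ (hp a ha)

theorem isSmoothCurve_comp_of_dSmooth_skeleton {d : ℕ} (hd : 0 < d) {f : M → N}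
    (hf : @DSmooth M N (skeleton d A.diffeology) (skeleton d B.diffeology) f) {c : ℝ → M}
    (hc : A.IsSmoothCurve c) : B.IsSmoothCurve (f ∘ c) :=
  isPlot_comp_coordinate_iff.1 (isPlot_of_isPlot_skeleton
    (hf 1 _ (isPlot_skeleton hd (isPlot_comp_coordinate_iff.2 hc))))

theorem isSmooth_iff_dSmooth {f : M → N} :
    A.IsSmooth B f ↔ @DSmooth M N A.diffeology B.diffeology f := by
  rw [isSmooth_iff_forall_isSmoothCurve]
  exact ⟨dSmooth_of_forall_isSmoothCurve, fun hf c hc =>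
    isSmoothCurve_comp_of_dSmooth_skeleton one_pos (dSmooth_skeleton hf) hc⟩

theorem dSmooth_iff_dSmooth_skeleton {d : ℕ} (hd : 0 < d) {f : M → N} :
    @DSmooth M N A.diffeology B.diffeology f ↔
      @DSmooth M N (skeleton d A.diffeology) (skeleton d B.diffeology) f :=
  ⟨dSmooth_skeleton, fun hf => dSmooth_of_forall_isSmoothCurve fun _ hc =>
    isSmoothCurve_comp_of_dSmooth_skeleton hd hf hc⟩

end Manifold
-- Homotopies whose hyperplane restrictions have rank at most `d`.
namespace Manifold

variable {N : Type*} {B : Manifold N}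

/-- The inclusion of `ℝ × ℝᵈ` into `ℝ × ℝᵈ⁺¹` as a coordinate hyperplane. -/
noncomputable def hyperplaneInclusion {d : ℕ} (i : Fin (d + 1)) :
    EuclideanSpace ℝ (Fin (d + 1)) →L[ℝ] ℝ × EuclideanSpace ℝ (Fin (d + 1)) :=
  (EuclideanSpace.proj 0).prod (∑ j : Fin d,
    (EuclideanSpace.proj j.succ : EuclideanSpace ℝ (Fin (d + 1)) →L[ℝ] ℝ).smulRight
      (EuclideanSpace.single (i.succAbove j) (1 : ℝ)))

theorem hyperplaneInclusion_apply {d : ℕ} (i : Fin (d + 1)) (z : EuclideanSpace ℝ (Fin (d + 1))) :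
    hyperplaneInclusion i z =
      (z 0, ∑ j : Fin d, z j.succ • EuclideanSpace.single (i.succAbove j) (1 : ℝ)) := by
  simp [hyperplaneInclusion]

theorem hyperplaneInclusion_snd_self {d : ℕ} (i : Fin (d + 1))
    (z : EuclideanSpace ℝ (Fin (d + 1))) : (hyperplaneInclusion i z).2 i = 0 := by
  simp [hyperplaneInclusion_apply]

theorem hyperplaneInclusion_snd_succAbove {d : ℕ} (i : Fin (d + 1))
    (z : EuclideanSpace ℝ (Fin (d + 1))) (j : Fin d) :
    (hyperplaneInclusion i z).2 (i.succAbove j) = z j.succ := by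
  simp [hyperplaneInclusion_apply, Pi.single_apply]

/-- A plot of the `d`-skeleton has rank at most `d`. -/
theorem exists_ne_zero_forall_fderiv_eq_zero {d n : ℕ} (hdn : d < n)
    {p : EuclideanSpace ℝ (Fin n) → N} (hp : @IsPlot N (skeleton d B.diffeology) n p)
    (x : EuclideanSpace ℝ (Fin n)) : ∃ k ≠ 0, ∀ ψ ∈ B.atlas, p x ∈ ψ.equiv.source →
      ∀ ℓ : ψ.model →L[ℝ] ℝ, fderiv ℝ (fun z => ℓ (ψ.equiv (p z))) x k = 0 := by
  obtain ⟨m, hm, r, h, hr, hh, hph⟩ := exists_factorization_of_isPlot_skeleton hp x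
  -- The inner map `h` lowers the dimension from `n` to `m ≤ d < n`; a kernel vector of its
  -- derivative serves all charts and functionals at once.
  have hker : LinearMap.ker (fderiv ℝ h x).toLinearMap ≠ ⊥ :=
    LinearMap.ker_ne_bot_of_finrank_lt (by simp; omega)
  obtain ⟨k, hk, hk0⟩ := (Submodule.ne_bot_iff _).1 hker
  refine ⟨k, hk0, fun ψ hψ hx ℓ => ?_⟩
  have hr' := isPlot_iff_smoothAlongCurves.1 hr
  have hxr : h x ∈ r ⁻¹' ψ.equiv.source := by
    rw [hph.eq_of_nhds] at hx
    exact hx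
  have hd : DifferentiableAt ℝ (fun y => ℓ (ψ.equiv (r y))) (h x) :=
    ((hr'.contDiffOn_one hψ ℓ).differentiableOn (by simp)).differentiableAt
      ((hr'.isOpen_preimage_source hψ).mem_nhds hxr)
  have e : (fun z => ℓ (ψ.equiv (p z))) =ᶠ[𝓝 x] (fun y => ℓ (ψ.equiv (r y))) ∘ h := by
    filter_upwards [hph] with z hz
    simp [hz]
  have hk' : fderiv ℝ h x k = 0 := hk
  rw [e.fderiv_eq, fderiv_comp x hd (hh.differentiable (by simp) x)]
  simp [hk']

section Homotopy

variable {d : ℕ} {Γ : ℝ × EuclideanSpace ℝ (Fin (d + 1)) → N}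

/-- If a homotopy restricted to coordinate hyperplanes consists of plots of the `d`-skeleton, then
its velocity vanishes wherever its spatial derivative is injective. -/
theorem fderiv_time_eq_zero (hΓ : B.SmoothAlongCurves Γ)
    (hsk : ∀ (i : Fin (d + 1)) (y : EuclideanSpace ℝ (Fin (d + 1))),
      @IsPlot N (skeleton d B.diffeology) (d + 1)
        fun z => Γ ((0, y) + hyperplaneInclusion i z))
    {ψ : Chart N} (hψ : ψ ∈ B.atlas) {p : ℝ × EuclideanSpace ℝ (Fin (d + 1))}
    (hp : Γ p ∈ ψ.equiv.source)
    (hinj : ∀ h : EuclideanSpace ℝ (Fin (d + 1)), h ≠ 0 →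
      ∃ ℓ : ψ.model →L[ℝ] ℝ, fderiv ℝ (fun q => ℓ (ψ.equiv (Γ q))) p (0, h) ≠ 0)
    (ℓ : ψ.model →L[ℝ] ℝ) : fderiv ℝ (fun q => ℓ (ψ.equiv (Γ q))) p (1, 0) = 0 := by
  have hinj' : ∀ h : EuclideanSpace ℝ (Fin (d + 1)), (∀ ℓ : ψ.model →L[ℝ] ℝ,
      fderiv ℝ (fun q => ℓ (ψ.equiv (Γ q))) p (0, h) = 0) → h = 0 := fun h hh => by
    by_contra hne
    obtain ⟨ℓ, hℓ⟩ := hinj h hne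
    exact hℓ (hh ℓ)
  have key : ∀ i : Fin (d + 1), ∃ w : EuclideanSpace ℝ (Fin (d + 1)), w i = 0 ∧
      ∀ ℓ : ψ.model →L[ℝ] ℝ, fderiv ℝ (fun q => ℓ (ψ.equiv (Γ q))) p (1, w) = 0 := by
    intro i
    have hx : (0, p.2) + hyperplaneInclusion i (EuclideanSpace.single 0 p.1) = p := by
      ext1 <;> simp [hyperplaneInclusion_apply]
    obtain ⟨k, hk0, hk⟩ := exists_ne_zero_forall_fderiv_eq_zero d.lt_succ_self (hsk i p.2)
      (EuclideanSpace.single 0 p.1)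
    have hk' : ∀ ℓ : ψ.model →L[ℝ] ℝ,
        fderiv ℝ (fun q => ℓ (ψ.equiv (Γ q))) p (hyperplaneInclusion i k) = 0 := by
      intro ℓ
      rw [← hk ψ hψ (by rwa [hx]) ℓ]
      have hd : DifferentiableAt ℝ (fun q => ℓ (ψ.equiv (Γ q)))
          ((0, p.2) + hyperplaneInclusion i (EuclideanSpace.single 0 p.1)) := by
        rw [hx]
        exact ((hΓ.contDiffOn_one hψ ℓ).differentiableOn (by simp)).differentiableAt
          ((hΓ.isOpen_preimage_source hψ).mem_nhds hp)
      have hJ := (hyperplaneInclusion i).hasFDerivAt (x := EuclideanSpace.single 0 p.1)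
        |>.const_add (0, p.2)
      have := (HasFDerivAt.comp (f := fun z => (0, p.2) + hyperplaneInclusion i z) _
        hd.hasFDerivAt hJ).fderiv
      rw [Function.comp_def] at this
      rw [this, hx]
      rfl
    -- A kernel vector without time component would be spatial, hence zero by injectivity.
    have hτ : k 0 ≠ 0 := by
      intro hτ
      have e : hyperplaneInclusion i k = (0, (hyperplaneInclusion i k).2) := by
        ext1
        · simp [hyperplaneInclusion_apply, hτ]
        · rfl
      have hz := hinj' (hyperplaneInclusion i k).2 fun ℓ => by rw [← e]; exact hk' ℓ
      refine hk0 ?_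
      ext j
      refine Fin.cases hτ (fun j => ?_) j
      rw [← hyperplaneInclusion_snd_succAbove i k j, hz]
      rfl
    refine ⟨(k 0)⁻¹ • (hyperplaneInclusion i k).2, ?_, fun ℓ => ?_⟩
    · simp [hyperplaneInclusion_snd_self]
    · have e : ((1 : ℝ), (k 0)⁻¹ • (hyperplaneInclusion i k).2) =
          (k 0)⁻¹ • hyperplaneInclusion i k := by
        ext1
        · simp [hyperplaneInclusion_apply, hτ]
        · rfl
      rw [e, map_smul, hk' ℓ, smul_zero]
  choose w hw hwℓ using key
  have heq : ∀ i, w i = w 0 := fun i => by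
    refine sub_eq_zero.1 (hinj' _ fun ℓ => ?_)
    have e : ((0 : ℝ), w i - w 0) = (1, w i) - (1, w 0) := by simp
    rw [e, map_sub, hwℓ, hwℓ, sub_zero]
  -- The common vector has vanishing `i`-th coordinate for every `i`.
  have h0 : w 0 = 0 := by
    ext i
    rw [← heq i, hw i]
    rfl
  rw [← h0]
  exact hwℓ 0 ℓ

/-- Injectivity of the spatial derivative is an open condition. -/
theorem eventually_forall_exists_fderiv_ne_zero (hΓ : B.SmoothAlongCurves Γ)
    {ψ : Chart N} (hψ : ψ ∈ B.atlas) {p : ℝ × EuclideanSpace ℝ (Fin (d + 1))}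
    (hp : Γ p ∈ ψ.equiv.source)
    (hinj : ∀ h : EuclideanSpace ℝ (Fin (d + 1)), h ≠ 0 →
      ∃ ℓ : ψ.model →L[ℝ] ℝ, fderiv ℝ (fun q => ℓ (ψ.equiv (Γ q))) p (0, h) ≠ 0) :
    ∀ᶠ q in 𝓝 p, ∀ h : EuclideanSpace ℝ (Fin (d + 1)), h ≠ 0 →
      ∃ ℓ : ψ.model →L[ℝ] ℝ, fderiv ℝ (fun q => ℓ (ψ.equiv (Γ q))) q (0, h) ≠ 0 := by
  have hO := hΓ.isOpen_preimage_source hψ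
  -- The functional `ℓ` depends on `h`, but each one works for all nearby points and directions;
  -- compactness of the unit sphere gives one neighbourhood for all directions.
  have := (isCompact_sphere (0 : EuclideanSpace ℝ (Fin (d + 1)))
    1).eventually_forall_of_forall_eventually (x₀ := p) (P := fun q h =>
      ∃ ℓ : ψ.model →L[ℝ] ℝ, fderiv ℝ (fun q => ℓ (ψ.equiv (Γ q))) q (0, h) ≠ 0) ?_
  · filter_upwards [this] with q hq h hh
    have hn : ‖h‖ ≠ 0 := norm_ne_zero_iff.2 hh
    obtain ⟨ℓ, hℓ⟩ := hq (‖h‖⁻¹ • h) (by simp [norm_smul, hn])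
    refine ⟨ℓ, fun h0 => hℓ ?_⟩
    have e : ((0 : ℝ), ‖h‖⁻¹ • h) = ‖h‖⁻¹ • ((0 : ℝ), h) := by simp
    rw [e, map_smul, h0, smul_zero]
  · intro h hh
    obtain ⟨ℓ, hℓ⟩ := hinj h (by rintro rfl; simp at hh)
    have hc : ContinuousAt (fderiv ℝ fun q => ℓ (ψ.equiv (Γ q))) p :=
      ((hΓ.contDiffOn_one hψ ℓ).continuousOn_fderiv_of_isOpen hO le_rfl).continuousAt
        (hO.mem_nhds hp)
    have hc' : ContinuousAt (fun z : (ℝ × EuclideanSpace ℝ (Fin (d + 1))) ×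
        EuclideanSpace ℝ (Fin (d + 1)) =>
        fderiv ℝ (fun q => ℓ (ψ.equiv (Γ q))) z.1 (0, z.2)) (p, h) := by
      refine ContinuousAt.clm_apply (ContinuousAt.comp (f := Prod.fst) hc continuousAt_fst) ?_
      fun_prop
    filter_upwards [hc'.eventually_ne hℓ] with z hz
    exact ⟨ℓ, hz⟩

/-- A homotopy as above is constant in time near a point where its spatial derivative is
injective. -/
theorem eventually_eq_of_injective (hΓ : B.SmoothAlongCurves Γ)
    (hsk : ∀ (i : Fin (d + 1)) (y : EuclideanSpace ℝ (Fin (d + 1))),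
      @IsPlot N (skeleton d B.diffeology) (d + 1)
        fun z => Γ ((0, y) + hyperplaneInclusion i z))
    {ψ : Chart N} (hψ : ψ ∈ B.atlas) {t₀ : ℝ} {y₀ : EuclideanSpace ℝ (Fin (d + 1))}
    (hp : Γ (t₀, y₀) ∈ ψ.equiv.source)
    (hinj : ∀ h : EuclideanSpace ℝ (Fin (d + 1)), h ≠ 0 →
      ∃ ℓ : ψ.model →L[ℝ] ℝ, fderiv ℝ (fun q => ℓ (ψ.equiv (Γ q))) (t₀, y₀) (0, h) ≠ 0) :
    ∀ᶠ t in 𝓝 t₀, ∀ᶠ y in 𝓝 y₀, Γ (t, y) = Γ (t₀, y) := by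
  have hO := hΓ.isOpen_preimage_source hψ
  have hev := (hO.eventually_mem hp).and (eventually_forall_exists_fderiv_ne_zero hΓ hψ hp hinj)
  obtain ⟨ε, hε, hball⟩ := Metric.eventually_nhds_iff_ball.1 hev
  rw [← ball_prod_same] at hball
  filter_upwards [Metric.ball_mem_nhds t₀ hε] with t ht
  filter_upwards [Metric.ball_mem_nhds y₀ hε] with y hy
  have hmem : ∀ s ∈ Metric.ball t₀ ε, (s, y) ∈ Metric.ball t₀ ε ×ˢ Metric.ball y₀ ε :=
    fun s hs => ⟨hs, hy⟩
  have ht₀ := Metric.mem_ball_self (x := t₀) hε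
  refine ψ.equiv.injOn (hball _ (hmem t ht)).1 (hball _ (hmem t₀ ht₀)).1 ?_
  by_contra hne
  obtain ⟨ℓ, hℓ⟩ := SeparatingDual.exists_separating_of_ne (R := ℝ) hne
  refine hℓ ?_
  have hd : ∀ s ∈ Metric.ball t₀ ε, HasDerivAt (fun s => ℓ (ψ.equiv (Γ (s, y)))) 0 s := by
    intro s hs
    have h1 : DifferentiableAt ℝ (fun q => ℓ (ψ.equiv (Γ q))) (s, y) :=
      ((hΓ.contDiffOn_one hψ ℓ).differentiableOn (by simp)).differentiableAt
        (hO.mem_nhds (hball _ (hmem s hs)).1)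
    have h2 : HasDerivAt (fun s : ℝ => (s, y)) ((1 : ℝ), (0 : EuclideanSpace ℝ (Fin (d + 1)))) s :=
      (hasDerivAt_id s).prodMk (hasDerivAt_const s y)
    have h3 := h1.hasFDerivAt.comp_hasDerivAt s h2
    rw [fderiv_time_eq_zero hΓ hsk hψ (hball _ (hmem s hs)).1 (hball _ (hmem s hs)).2] at h3
    exact h3
  have := (convex_ball t₀ ε).norm_image_sub_le_of_norm_deriv_le (C := 0)
    (fun s hs => (hd s hs).differentiableAt) (fun s hs => by rw [(hd s hs).deriv, norm_zero])
    ht₀ ht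
  rw [zero_mul, norm_le_zero_iff, sub_eq_zero] at this
  exact this

/-- The spatial derivative depends only on the germ of `Γ (t, ·)` at `y`, so it is unchanged between
times at which these germs agree. -/
theorem fderiv_space_eq_lineDeriv (hΓ : B.SmoothAlongCurves Γ)
    {ψ : Chart N} (hψ : ψ ∈ B.atlas) {t : ℝ} {y : EuclideanSpace ℝ (Fin (d + 1))}
    (hp : Γ (t, y) ∈ ψ.equiv.source) (ℓ : ψ.model →L[ℝ] ℝ) (h : EuclideanSpace ℝ (Fin (d + 1))) :
    fderiv ℝ (fun q => ℓ (ψ.equiv (Γ q))) (t, y) (0, h) =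
      lineDeriv ℝ (fun y => ℓ (ψ.equiv (Γ (t, y)))) y h := by
  have h1 : DifferentiableAt ℝ (fun q => ℓ (ψ.equiv (Γ q))) (t, y) :=
    ((hΓ.contDiffOn_one hψ ℓ).differentiableOn (by simp)).differentiableAt
      ((hΓ.isOpen_preimage_source hψ).mem_nhds hp)
  rw [← h1.lineDeriv_eq_fderiv]
  simp [lineDeriv]

/-- A homotopy whose restrictions to coordinate hyperplanes are plots of the `d`-skeleton and whose
initial map is immersive at the origin fixes the origin. -/
theorem eq_of_immersive (hB : IsSeparated B.topology) (hΓ : B.SmoothAlongCurves Γ)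
    (hsk : ∀ (i : Fin (d + 1)) (y : EuclideanSpace ℝ (Fin (d + 1))),
      @IsPlot N (skeleton d B.diffeology) (d + 1)
        fun z => Γ ((0, y) + hyperplaneInclusion i z))
    (himm : ∀ ψ ∈ B.atlas, Γ (0, 0) ∈ ψ.equiv.source → ∀ h, h ≠ 0 →
      ¬ HasDirDerivAt (fun y => ψ.equiv (Γ (0, y))) 0 h 0) (t : ℝ) : Γ (t, 0) = Γ (0, 0) := by
  obtain ⟨ψ, hψ, h0⟩ := B.exists_chart (Γ (0, 0))
  have hO := hΓ.isOpen_preimage_source hψ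
  have hinj : ∀ h : EuclideanSpace ℝ (Fin (d + 1)), h ≠ 0 →
      ∃ ℓ : ψ.model →L[ℝ] ℝ, fderiv ℝ (fun q => ℓ (ψ.equiv (Γ q))) (0, 0) (0, h) ≠ 0 := by
    -- The velocity of `Γ (0, s • h)` at `s = 0` exists and is nonzero by `himm`, so some functional
    -- detects it.
    intro h hh
    have ha : ContDiff ℝ ∞ fun s : ℝ => ((0 : ℝ), s • h) := by fun_prop
    obtain ⟨e, he, hce⟩ := hΓ _ ha 0 ψ hψ (by simpa using h0)
    obtain ⟨e', -, hv⟩ := he.exists_velocity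
    have hce' : e =ᶠ[𝓝 0] fun s => ψ.equiv (Γ (0, s • h)) :=
      hce.mono fun s hs => hs.2.symm
    have hv0 := (hv 0).congr hce'
    have hne : e' 0 ≠ 0 := by
      intro he0
      refine himm ψ hψ h0 h hh ?_
      rw [he0] at hv0
      simpa [HasDirDerivAt] using hv0
    obtain ⟨ℓ, hℓ⟩ := SeparatingDual.exists_ne_zero (R := ℝ) hne
    refine ⟨ℓ, ?_⟩
    rw [fderiv_space_eq_lineDeriv hΓ hψ h0]
    have := hasDerivAt_iff_tendsto_slope_zero.2 (hv0.clm_comp ℓ)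
    rw [lineDeriv]
    simp only [zero_add]
    rw [show (fun s : ℝ => ℓ (ψ.equiv (Γ (0, s • h)))) =
      ℓ ∘ fun s : ℝ => ψ.equiv (Γ (0, s • h)) from rfl, this.deriv]
    exact hℓ
  -- Keeping the spatial derivative in `C` preserves its injectivity, so that local constancy in
  -- time applies again at each time in `C`.
  let K : Set ℝ := {t | Γ (t, 0) = Γ (0, 0)}
  let C : Set ℝ := {t | t ∈ K ∧ ∀ (ℓ : ψ.model →L[ℝ] ℝ) (h : EuclideanSpace ℝ (Fin (d + 1))),
    fderiv ℝ (fun q => ℓ (ψ.equiv (Γ q))) (t, 0) (0, h) =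
      fderiv ℝ (fun q => ℓ (ψ.equiv (Γ q))) (0, 0) (0, h)}
  have hK : IsClosed K :=
    isClosed_setOf_eq hB (hΓ (fun t => (t, 0)) (by fun_prop)) (hΓ (fun _ => (0, 0)) contDiff_const)
  have hKs : ∀ t ∈ K, Γ (t, 0) ∈ ψ.equiv.source := fun t ht => by
    rw [show Γ (t, 0) = Γ (0, 0) from ht]
    exact h0
  have hCc : IsClosed C := by
    -- The factor `K` is repeated because the derivatives are known to be continuous only where `Γ
    -- (t, 0)` stays in the chart, in particular on the closed set `K`.
    have e : C = K ∩ ⋂ (ℓ : ψ.model →L[ℝ] ℝ) (h : EuclideanSpace ℝ (Fin (d + 1))), K ∩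
        (fun t => fderiv ℝ (fun q => ℓ (ψ.equiv (Γ q))) (t, 0) (0, h)) ⁻¹'
          {fderiv ℝ (fun q => ℓ (ψ.equiv (Γ q))) (0, 0) (0, h)} := by
      ext t
      simp only [C, Set.mem_ofPred_eq, Set.mem_inter_iff, Set.mem_iInter, Set.mem_preimage,
        Set.mem_singleton_iff]
      exact ⟨fun h => ⟨h.1, fun ℓ v => ⟨h.1, h.2 ℓ v⟩⟩, fun h => ⟨h.1, fun ℓ v => (h.2 ℓ v).2⟩⟩
    rw [e]
    refine hK.inter (isClosed_iInter fun ℓ => isClosed_iInter fun h => ?_)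
    refine ContinuousOn.preimage_isClosed_of_isClosed ?_ hK isClosed_singleton
    have h1 := (hΓ.contDiffOn_one hψ ℓ).continuousOn_fderiv_of_isOpen hO le_rfl
    have h2 : ContinuousOn (fun t : ℝ => fderiv ℝ (fun q => ℓ (ψ.equiv (Γ q)))
        (t, (0 : EuclideanSpace ℝ (Fin (d + 1))))) K :=
      h1.comp (by fun_prop) hKs
    exact h2.clm_apply continuousOn_const
  have hCo : IsOpen C := by
    rw [isOpen_iff_mem_nhds]
    rintro t₀ ⟨htK, htD⟩
    have hev := eventually_eq_of_injective hΓ hsk hψ (hKs t₀ htK) fun h hh => by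
      obtain ⟨ℓ, hℓ⟩ := hinj h hh
      exact ⟨ℓ, by rwa [htD]⟩
    filter_upwards [hev] with t ht
    have htK' : t ∈ K := ht.self_of_nhds.trans htK
    refine ⟨htK', fun ℓ h => ?_⟩
    rw [← htD, fderiv_space_eq_lineDeriv hΓ hψ (hKs t htK'),
      fderiv_space_eq_lineDeriv hΓ hψ (hKs t₀ htK), lineDeriv, lineDeriv]
    refine EventuallyEq.deriv_eq ?_
    have hlim : Tendsto (fun s : ℝ => (0 : EuclideanSpace ℝ (Fin (d + 1))) + s • h)
        (𝓝 0) (𝓝 0) := by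
      have : Continuous fun s : ℝ => (0 : EuclideanSpace ℝ (Fin (d + 1))) + s • h := by fun_prop
      simpa using this.tendsto 0
    filter_upwards [hlim.eventually ht] with s hs
    rw [hs]
  have huniv : C = Set.univ := IsClopen.eq_univ ⟨hCc, hCo⟩ ⟨0, rfl, fun _ _ => rfl⟩
  exact (huniv ▸ Set.mem_univ t : t ∈ C).1

end Homotopy

end Manifold
-- Smooth paths and connected components for the D-topology.
section Paths

variable {X Y : Type*} {DX : DiffeologicalSpace X} {DY : DiffeologicalSpace Y}

theorem isPlot_of_smoothPath {γ : ℝ → SmoothMaps DX DY} (hγ : DSmooth γ) {k : ℕ}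
    {τ : EuclideanSpace ℝ (Fin k) → ℝ} (hτ : ContDiff ℝ ∞ τ) {q : EuclideanSpace ℝ (Fin k) → X}
    (hq : @IsPlot X DX k q) : @IsPlot Y DY k fun z => (γ (τ z)).1 (q z) := by
  have h1 : IsPlot fun z : EuclideanSpace ℝ (Fin 1) => γ (z 0) :=
    hγ 1 (fun z => z 0) (isPlot_iff_contDiff.2 (by fun_prop))
  exact h1 k (fun z => WithLp.toLp 2 fun _ => τ z) q
    (contDiff_euclidean.2 fun _ => hτ) hq

/-- A point that is alone in its smooth path component is alone in its connected component. -/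
theorem connectedComponent_eq_singleton_of_smoothComponent {Z : Type*} [DiffeologicalSpace Z]
    {f : Z} (h : smoothComponent f ⊆ {f}) : @connectedComponent Z dTopology f = {f} := by
  let _ : TopologicalSpace Z := dTopology
  have hclopen : IsClopen ({f} : Set Z) := by
    -- Any two parameters are joined by a line, which a plot maps to a smooth path. So a plot that
    -- meets `f` is constantly `f`, and `{f}` is clopen.
    have key : ∀ (n : ℕ) (p : EuclideanSpace ℝ (Fin n) → Z), IsPlot p →
        p ⁻¹' {f} = ∅ ∨ p ⁻¹' {f} = Set.univ := by
      intro n p hp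
      refine (p ⁻¹' {f}).eq_empty_or_nonempty.imp_right ?_
      rintro ⟨a, ha⟩
      refine Set.eq_univ_of_forall fun b => h ⟨fun s => p (a + s • (b - a)), ?_, ?_, ?_⟩
      · exact hp.dSmooth.comp (ContDiff.dSmooth (by fun_prop))
      · simpa using ha
      · simp
    refine ⟨⟨isOpen_iff_preimages_plots.2 fun n p hp => ?_⟩,
      isOpen_iff_preimages_plots.2 fun n p hp => ?_⟩ <;>
    rcases key n p hp with e | e <;> simp [Set.preimage_compl, e]
  exact Set.Subset.antisymm (hclopen.connectedComponent_subset rfl)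
    (Set.singleton_subset_iff.2 mem_connectedComponent)

end Paths

/-! ### Part (2): immersions are isolated. -/

namespace Manifold

variable {M : Type*} {N : Type*} {A : Manifold M} {B : Manifold N}

/-- A linear map on `ℝⁿ` is a finite sum of coordinates times fixed vectors, so no continuity
assumption on `j` is needed. -/
theorem smoothCurve_affine {V : ConvenientSpace} {n : ℕ} (x : V) (j : (Fin n → ℝ) →ₗ[ℝ] V)
    {a : ℝ → EuclideanSpace ℝ (Fin n)} (ha : ContDiff ℝ ∞ a) :
    SmoothCurve fun t => x + j (a t) := by
  have h : SmoothCurve ((fun _ => x) + ∑ i, fun t => a t i • j (Pi.single i 1)) :=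
    (smoothCurve_const x).add (SmoothCurve.sum _ fun i _ => SmoothCurve.smul_const
      (contDiff_euclidean.1 ha i) _)
  convert h using 1
  funext t
  rw [Pi.add_apply, Finset.sum_apply, LinearMap.pi_apply_eq_sum_univ j (a t)]
  congr! 4 with i
  funext k
  simp [Pi.single_apply, eq_comm]

/-- Smooth paths in the space of smooth maps of `d`-skeleta are constant if they start at an
immersion of a manifold of dimension greater than `d`. -/
theorem smoothPath_eq_of_isImmersion (hB : IsSeparated B.topology) {d : ℕ} (hd : 0 < d)
    (hdim : A.DimGT d)
    {γ : ℝ → SmoothMaps (skeleton d A.diffeology) (skeleton d B.diffeology)} (hγ : DSmooth γ)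
    (himm : A.IsImmersion B (γ 0).1) (t : ℝ) : γ t = γ 0 := by
  refine Subtype.ext (funext fun x => ?_)
  obtain ⟨φ, hφ, hx⟩ := A.exists_chart x
  obtain ⟨j, hj⟩ := (Module.le_rank_iff_exists_linearMap (R := ℝ) (M := φ.model)
    (n := d + 1)).1 (by
      rw [Nat.cast_add_one, ← Cardinal.succ_natCast]
      exact Order.succ_le_of_lt (hdim x φ hφ hx))
  let aff : EuclideanSpace ℝ (Fin (d + 1)) → φ.model := fun y => φ.equiv x + j y
  have haff : ∀ a : ℝ → EuclideanSpace ℝ (Fin (d + 1)), ContDiff ℝ ∞ a → SmoothCurve (aff ∘ a) :=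
    fun a ha => smoothCurve_affine _ j ha
  have hO : IsOpen (aff ⁻¹' φ.equiv.target) := isOpen_of_forall_contDiff fun c hc t ht =>
    (isCInftyOpen_iff.1 φ.isCInftyOpen_target _ (haff c hc)).mem_nhds ht
  have haff0 : aff 0 = φ.equiv x := by simp [aff]
  -- The cut-off makes the affine slice globally defined on `ℝᵈ⁺¹` while keeping its germ at `0`.
  obtain ⟨θ, hθ, hθ0, hθO⟩ := exists_contDiff_eventuallyEq_id (hO.mem_nhds
    (show (0 : EuclideanSpace ℝ (Fin (d + 1))) ∈ _ by
      rw [Set.mem_preimage, haff0]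
      exact φ.equiv.map_source hx))
  let q : EuclideanSpace ℝ (Fin (d + 1)) → M := fun y => φ.equiv.symm (aff (θ y))
  have hq : A.SmoothAlongCurves q := fun a ha =>
    isSmoothCurve_chart_symm hφ (haff _ (hθ.comp ha)) fun t => hθO (a t)
  have hq0 : q 0 = x := by
    simp only [q, hθ0.eq_of_nhds, id, haff0, φ.equiv.left_inv hx]
  have hqp : @IsPlot M A.diffeology _ q := isPlot_iff_smoothAlongCurves.2 hq
  have main := eq_of_immersive (Γ := fun z => (γ z.1).1 (q z.2)) hB ?_ ?_ ?_ t
  · simpa only [hq0] using main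
  · intro a ha
    refine isPlot_comp_coordinate_iff.1 (isPlot_of_isPlot_skeleton (d := d) ?_)
    refine isPlot_of_smoothPath hγ (τ := fun z => (a (z 0)).1) (q := fun z => q (a (z 0)).2)
      (by fun_prop) (isPlot_skeleton hd ?_)
    exact isPlot_comp_coordinate_iff.2 (hq (fun s => (a s).2) (by fun_prop))
  -- A hyperplane has dimension `d`, so `q` restricted to it is a plot of `M_d`; only then may the
  -- path `γ` be applied to it.
  · intro i y
    have hb : @IsPlot M (skeleton d A.diffeology) d fun σ : EuclideanSpace ℝ (Fin d) =>
        q (y + ∑ j, σ j • EuclideanSpace.single (i.succAbove j) (1 : ℝ)) :=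
      isPlot_skeleton le_rfl (A.diffeology.plot_reparam hqp (by fun_prop))
    have hb' := (skeleton d A.diffeology).plot_reparam hb
      (f := fun z : EuclideanSpace ℝ (Fin (d + 1)) => WithLp.toLp 2 fun j : Fin d => z j.succ)
      (contDiff_euclidean.2 fun j => by fun_prop)
    have := isPlot_of_smoothPath hγ (τ := fun z : EuclideanSpace ℝ (Fin (d + 1)) => z 0)
      (by fun_prop) hb'
    simpa [hyperplaneInclusion_apply, Function.comp_def] using this
  · intro ψ hψ hψ0 h hh hdir
    simp only [hq0] at hψ0
    refine hh ?_
    have h1 : HasDirDerivAt (ψ.equiv ∘ (γ 0).1 ∘ φ.equiv.symm) (φ.equiv x) (j h) 0 := by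
      refine HasVelocityAt.congr hdir ?_
      have hlim : Tendsto (fun s : ℝ => (0 : EuclideanSpace ℝ (Fin (d + 1))) + s • h)
          (𝓝 0) (𝓝 0) := by
        have : Continuous fun s : ℝ => (0 : EuclideanSpace ℝ (Fin (d + 1))) + s • h := by fun_prop
        simpa using this.tendsto 0
      filter_upwards [hlim.eventually hθ0] with s hs
      rw [zero_add] at hs
      simp [q, hs, aff]
    -- The direction `0` also has derivative `0`, so the immersion condition gives `j h = 0`, and
    -- `j` is injective.
    have h2 : HasDirDerivAt (ψ.equiv ∘ (γ 0).1 ∘ φ.equiv.symm) (φ.equiv x) 0 0 := by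
      simp [HasDirDerivAt, HasVelocityAt]
    have h3 := himm.2 x φ hφ hx ψ hψ hψ0 _ _ _ h1 h2
    have h4 : (h : Fin (d + 1) → ℝ) = 0 := hj (by rw [h3, map_zero])
    ext i
    exact congrFun h4 i

end Manifold
end Convenient

theorem theorem1p2 {M : Type uM} {N : Type uN}
    (A : Convenient.Manifold.{uM, vM} M) (B : Convenient.Manifold.{uN, vN} N)
    (hA : Convenient.IsSeparated A.topology) (hB : Convenient.IsSeparated B.topology)
    (d : ℕ) (hd : 0 < d) :
    ({f : M → N | A.IsSmooth B f} =
        {f : M → N | @Diffeology.DSmooth M N A.diffeology B.diffeology f} ∧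
      {f : M → N | @Diffeology.DSmooth M N A.diffeology B.diffeology f} =
        {f : M → N | @Diffeology.DSmooth M N
          (Convenient.skeleton d A.diffeology) (Convenient.skeleton d B.diffeology) f}) ∧
    (A.DimGT d →
      ∀ f : Convenient.SmoothMaps
          (Convenient.skeleton d A.diffeology) (Convenient.skeleton d B.diffeology),
        A.IsImmersion B f.1 →
          Convenient.smoothComponent f = {f} ∧
          @connectedComponent _ Diffeology.dTopology f = {f}) := by
  refine ⟨⟨Set.ext fun f => Convenient.Manifold.isSmooth_iff_dSmooth,
    Set.ext fun f => Convenient.Manifold.dSmooth_iff_dSmooth_skeleton hd⟩, fun hdim f hf => ?_⟩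
  have hsub : Convenient.smoothComponent f ⊆ {f} := by
    rintro g ⟨γ, hγ, h0, rfl⟩
    rw [Set.mem_singleton_iff, ← h0]
    exact Convenient.Manifold.smoothPath_eq_of_isImmersion hB hd hdim hγ (by rwa [h0]) 1
  exact ⟨hsub.antisymm (Set.singleton_subset_iff.2
      ⟨fun _ => f, Diffeology.dSmooth_const, rfl, rfl⟩),
    Convenient.connectedComponent_eq_singleton_of_smoothComponent hsub⟩
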